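/- Let $(M,g)$ be a smooth Riemannian manifold (without boundary, second countable) of dimension $d\ge 1$, and let $\mu$ be a Borel probability measure on $M$ which is absolutely continuous with respect to the Riemannian volume measure. For sets $A\subset\Omega\subset M$, with $\Omega$ measurable, let $$\mathrm{Cap}_\mu(A,\Omega)=\inf\Big\{\int|\nabla f|^2\,d\mu\;;\; f:M\to\mathbb R \text{ locally Lipschitz},\ f\ge 1\text{ on }A,\ f=0\text{ on }M\setminus\Omega\Big\}\in[0,\infty]$$ (a locally Lipschitz function is differentiable $\mu$-almost everywhere), where $\inf\emptyset=+\infty$, and, if $\mu(A)<1/2$, let $$\mathrm{Cap}_\mu(A)=\inf\big\{\mathrm{Cap}_\mu(A,\Omega)\;;\;A\subset\Omega,\ \mu(\Omega)\le 1/2\big\}.$$ Let $\beta:[1,\infty)\to[0,\infty)$ be a function such that every measurable set $A\subset M$ with $\mu(A)<1/2$ satisfies $$\mathrm{Cap}_\mu(A)\ \ge\ \sup_{s\ge 1}\ \frac1{\beta(s)}\cdot\frac{\mu(A)}{1+(s-1)\mu(A)},$$ with the conventions $1/0=+\infty$ and $\infty\cdot 0=0$. Then for every smooth function $f:M\to\mathbb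 R$ and every $s\ge 1$, $$\int f^2\,d\mu-s\Big(\int|f|\,d\mu\Big)^2\ \le\ 4\beta(s)\int|\nabla f|^2\,d\mu .$$ Here all integrals are taken in $[0,\infty]$, with $0\cdot\infty=0$ on the right-hand side, and the inequality is understood as $\int f^2\,d\mu\le 4\beta(s)\int|\nabla f|^2\,d\mu+s\big(\int|f|\,d\mu\big)^2$, so that no integrability of $f$ or $\nabla f$ is assumed. -/

import Mathlib

open Bundle MeasureTheory Manifold
open scoped ContDiff ENNReal NNReal

noncomputable section

namespace RiemannianCapacity

section Gradient

variable {d : ℕ} {M : Type*} [TopologicalSpace M] [ChartedSpace (EuclideanSpace ℝ (Fin d)) M]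
  [RiemannianBundle (fun x : M ↦ TangentSpace (𝓡 d) x)]

/-- The differential of a real function, as a continuous linear form on the tangent space at `x`.
(It is `0` at the points where `f` is not differentiable.) -/
def differential (f : M → ℝ) (x : M) : TangentSpace (𝓡 d) x →L[ℝ] ℝ :=
  mfderiv (𝓡 d) 𝓘(ℝ, ℝ) f x

theorem completeSpace_tangentSpace (x : M) : CompleteSpace (TangentSpace (𝓡 d) x) :=
  haveI : FiniteDimensional ℝ (TangentSpace (𝓡 d) x) :=
    inferInstanceAs (FiniteDimensional ℝ (EuclideanSpace ℝ (Fin d)))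
  FiniteDimensional.complete ℝ (TangentSpace (𝓡 d) x)

variable (d) in
/-- The Riemannian gradient: the tangent vector that represents the differential of `f` at `x` for
the Riemannian inner product. -/
def gradient (f : M → ℝ) (x : M) : TangentSpace (𝓡 d) x :=
  haveI := completeSpace_tangentSpace (d := d) x
  (InnerProductSpace.toDual ℝ (TangentSpace (𝓡 d) x)).symm (differential f x)

theorem inner_gradient (f : M → ℝ) (x : M) (v : TangentSpace (𝓡 d) x) :
    inner ℝ (gradient d f x) v = differential f x v := by
  have := completeSpace_tangentSpace (d := d) x
  exact InnerProductSpace.toDual_symm_apply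

theorem norm_gradient (f : M → ℝ) (x : M) : ‖gradient d f x‖ = ‖differential (d := d) f x‖ := by
  have := completeSpace_tangentSpace (d := d) x
  exact LinearIsometryEquiv.norm_map _ _

variable (d) in
/-- The Dirichlet energy `∫ |∇f|² dμ`, with values in `[0, ∞]`. -/
def energy [MeasurableSpace M] (μ : Measure M) (f : M → ℝ) : ℝ≥0∞ :=
  ∫⁻ x, ‖gradient d f x‖ₑ ^ 2 ∂μ

end Gradient

section Volume

variable {d : ℕ} {M : Type*} [TopologicalSpace M] [ChartedSpace (EuclideanSpace ℝ (Fin d)) M]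
  [RiemannianBundle (fun x : M ↦ TangentSpace (𝓡 d) x)]

variable (d) in
/-- The matrix `(g_ij)` of the metric in the coordinates given by the chart at `p`, at the point
with coordinates `y`. -/
def metricMatrix (p : M) (y : EuclideanSpace ℝ (Fin d)) : Matrix (Fin d) (Fin d) ℝ :=
  Matrix.of fun i j ↦ inner ℝ
    (mfderiv (𝓡 d) (𝓡 d) (chartAt (EuclideanSpace ℝ (Fin d)) p).symm y
      (EuclideanSpace.single i (1 : ℝ)))
    (mfderiv (𝓡 d) (𝓡 d) (chartAt (EuclideanSpace ℝ (Fin d)) p).symm y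
      (EuclideanSpace.single j (1 : ℝ)))

variable (d) in
/-- The coordinate volume `√(det g_ij) dy` of the chart at `p`, carried back to `M`: a measure
concentrated on the domain of that chart. -/
def chartVolume [MeasurableSpace M] (p : M) : Measure M :=
  Measure.map (chartAt (EuclideanSpace ℝ (Fin d)) p).symm
    ((volume.restrict (chartAt (EuclideanSpace ℝ (Fin d)) p).target).withDensity
      fun y ↦ ENNReal.ofReal √(metricMatrix d p y).det)

variable (d M) in
/-- The Riemannian volume measure. The measures `√(det g_ij) dy` of two charts agree on the
intersection of their domains; the volume measure is the measure whose restriction to the domain of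
each chart is the coordinate volume of this chart, that is, the supremum (in the lattice of
measures) of the coordinate volumes. -/
def riemannianVolume [MeasurableSpace M] : Measure M :=
  ⨆ p : M, chartVolume d p

/-- The coordinate volume of a Borel set is the integral of `√(det g_ij)` over its image under the
chart. -/
theorem chartVolume_apply [MeasurableSpace M] [BorelSpace M] (p : M) {A : Set M}
    (hA : MeasurableSet A) :
    chartVolume d p A =
      ∫⁻ y in (chartAt (EuclideanSpace ℝ (Fin d)) p).target ∩
          (chartAt (EuclideanSpace ℝ (Fin d)) p).symm ⁻¹' A,
        ENNReal.ofReal √(metricMatrix d p y).det := by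
  set φ := chartAt (EuclideanSpace ℝ (Fin d)) p
  have h1 : AEMeasurable φ.symm (volume.restrict φ.target) :=
    φ.continuousOn_symm.aemeasurable φ.open_target.measurableSet
  rw [chartVolume, Measure.map_apply_of_aemeasurable
    (h1.mono_ac (withDensity_absolutelyContinuous _ _)) hA, withDensity_apply',
    Measure.restrict_restrict₀ (h1.nullMeasurable hA), Set.inter_comm]

end Volume

section Capacity

variable {M : Type*} [EMetricSpace M] [MeasurableSpace M]

variable (d : ℕ) [ChartedSpace (EuclideanSpace ℝ (Fin d)) M]
  [RiemannianBundle (fun x : M ↦ TangentSpace (𝓡 d) x)]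

/-- `Cap_μ(A, Ω)`: the infimum of `∫ |∇f|² dμ` over the locally Lipschitz functions `f` that are at
least `1` on `A` and vanish outside `Ω`. -/
def relCapacity (μ : Measure M) (A Ω : Set M) : ℝ≥0∞ :=
  ⨅ (f : M → ℝ) (_ : LocallyLipschitz f) (_ : ∀ x ∈ A, 1 ≤ f x) (_ : ∀ x ∉ Ω, f x = 0),
    energy d μ f

/-- `Cap_μ(A)`: the infimum of `Cap_μ(A, Ω)` over the measurable sets `Ω ⊇ A` with
`μ(Ω) ≤ 1/2`. -/
def capacity (μ : Measure M) (A : Set M) : ℝ≥0∞ :=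
  ⨅ (Ω : Set M) (_ : MeasurableSet Ω) (_ : A ⊆ Ω) (_ : μ Ω ≤ 1 / 2), relCapacity d μ A Ω

end Capacity

end RiemannianCapacity

end

/-!
Let `F = |f|`, let `m` be a median of `F`, and cut `F` into `u = (F - m)⁺` and `u = (m - F)⁺`. Each
part vanishes outside a set of measure at most `1/2`, and it is enough to prove, for each of them,
`∫ u² ≤ 4 β(s) ∫_{u > 0} |∇f|² + (s - 1) (∫ u)²`: the variance of `F` is at most `∫ (F - m)²`, and
`(∫ F)²` is at least the sum of the two `(∫ u)²` (`lintegral_sq_le_of_parts`).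

For one part, take the weight `g = u / (c + u)` with `c = (s - 1) ∫ u`. On the one hand
`∫ u² (1 - g) ≤ (s - 1) (∫ u)²` (`lintegral_sq_le_weight`). On the other hand, by concavity of
`u ↦ u / (c + u)`, the measure `ν = g μ` satisfies `ν A ≤ μ A / (1 + (s - 1) μ A)`
(`withDensity_weight_le`), so that the hypothesis gives `ν A ≤ β(s) Cap(A, {u > 0})` for the
superlevel sets of `u`. The hypothesis only covers sets of measure less than `1/2`; sets of measure
`1/2` are reached by removing sets of small positive measure (`profile_le_relCapacity`), which exist
because `μ`, like the Riemannian volume, has no atoms. The same remark shows that `β(s)` is positive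
(`pos_of_forall_le_capacity`), since small balls have finite capacity.

What remains, `∫ u² dν ≤ 4 β(s) ∫ |∇u|² dμ`, is Maz'ya's capacitary inequality with its sharp
constant (`lintegral_sq_le_of_capacity`). It is obtained without the coarea formula. For the levels
`0, 1, 2, …` of a multiple `v` of `u`, let `γ j` be the energy of `v` between the levels `j` and
`j + 1`. A competitor `H ∘ v` with `H` of slope proportional to `1 / γ j` on `[j, j + 1]` bounds the
capacity of `{v ≥ k + 1}` by `1 / (1 / γ 0 + ⋯ + 1 / γ k)`, and a discrete Hardy inequality
(`sum_odd_div_sum_le`) sums these bounds to `4 ∑ γ j`. The functions `H` are of class `C^1`, and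
flat near `0` and near the level `k + 1`, so that the chain rule gives the energy of the
competitors; the points where `u` is not differentiable, on the boundary of `{u > 0}` or at a
maximum of `u`, do not matter. The competitors are locally Lipschitz because smooth functions are
locally Lipschitz for the Riemannian distance (`locallyLipschitz_of_contMDiff`).
-/

noncomputable section

namespace RiemannianCapacity

/-! ### Gradients of smooth functions -/

section Geometry

open Set Filter Topology

variable {d : ℕ} {M : Type*}

section Topological

variable [TopologicalSpace M] [ChartedSpace (EuclideanSpace ℝ (Fin d)) M]
  [RiemannianBundle (fun x : M ↦ TangentSpace (𝓡 d) x)]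

theorem enorm_gradient_le_of_bound {f : M → ℝ} {x : M} {C : ℝ≥0}
    (h : ∀ v : TangentSpace (𝓡 d) x, |differential f x v| ≤ C * ‖v‖) :
    ‖gradient d f x‖ₑ ≤ C := by
  rw [← ofReal_norm, norm_gradient, ← ENNReal.ofReal_coe_nnreal]
  exact ENNReal.ofReal_le_ofReal (ContinuousLinearMap.opNorm_le_bound _ C.2 h)

theorem abs_differential_le (f : M → ℝ) (x : M) (v : TangentSpace (𝓡 d) x) :
    |differential f x v| ≤ ‖gradient d f x‖ * ‖v‖ := by
  rw [norm_gradient]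
  exact ContinuousLinearMap.le_opNorm (differential (d := d) f x) v

theorem differential_comp {M : Type*} [TopologicalSpace M]
    [ChartedSpace (EuclideanSpace ℝ (Fin d)) M] {H : ℝ → ℝ} {f : M → ℝ} {x : M}
    (hH : DifferentiableAt ℝ H (f x)) (hf : MDifferentiableAt (𝓡 d) 𝓘(ℝ, ℝ) f x)
    (v : TangentSpace (𝓡 d) x) :
    differential (H ∘ f) x v = deriv H (f x) * differential f x v := by
  have h2 := mfderiv_comp x hH.mdifferentiableAt hf
  simp only [differential, h2, mfderiv_eq_fderiv]
  change fderiv ℝ H (f x) (mfderiv (𝓡 d) 𝓘(ℝ, ℝ) f x v : ℝ) = _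
  exact fderiv_eq_deriv_mul

theorem enorm_gradient_comp_le {H : ℝ → ℝ} {f : M → ℝ} {x : M} (hH : DifferentiableAt ℝ H (f x))
    (hf : MDifferentiableAt (𝓡 d) 𝓘(ℝ, ℝ) f x) :
    ‖gradient d (H ∘ f) x‖ₑ ≤ ‖deriv H (f x)‖ₑ * ‖gradient d f x‖ₑ := by
  have h1 : ‖deriv H (f x)‖ₑ * ‖gradient d f x‖ₑ
      = (‖deriv H (f x)‖₊ * ‖gradient d f x‖₊ : ℝ≥0) := by
    rw [ENNReal.coe_mul]; rfl
  rw [h1]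
  refine enorm_gradient_le_of_bound fun v ↦ ?_
  rw [differential_comp hH hf, abs_mul, NNReal.coe_mul, coe_nnnorm, coe_nnnorm, mul_assoc,
    Real.norm_eq_abs]
  gcongr
  exact abs_differential_le f x v

theorem enorm_gradient_eq_zero_of_eventually_const {f : M → ℝ} {x : M} {c : ℝ}
    (h : ∀ᶠ y in 𝓝 x, f y = c) : ‖gradient d f x‖ₑ = 0 := by
  have h0 : f =ᶠ[𝓝 x] fun _ ↦ c := h
  have h1 : differential (d := d) f x = 0 := by
    rw [differential, h0.mfderiv_eq, mfderiv_const]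
    rfl
  refine le_antisymm (enorm_gradient_le_of_bound (C := 0) fun v ↦ ?_) bot_le
  rw [h1]
  simp

theorem mdifferentiableAt_comp_and_enorm_gradient_le {ψ : ℝ → ℝ}
    (hψ : LipschitzWith 1 ψ) {f : M → ℝ} {x : M}
    (hψd : DifferentiableAt ℝ ψ (f x)) (hf : MDifferentiableAt (𝓡 d) 𝓘(ℝ, ℝ) f x) :
    MDifferentiableAt (𝓡 d) 𝓘(ℝ, ℝ) (ψ ∘ f) x ∧ ‖gradient d (ψ ∘ f) x‖ₑ ≤ ‖gradient d f x‖ₑ := by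
  refine ⟨hψd.mdifferentiableAt.comp x hf, (enorm_gradient_comp_le hψd hf).trans ?_⟩
  have h1 : ‖deriv ψ (f x)‖ₑ ≤ 1 := by
    rw [← ofReal_norm]
    exact ENNReal.ofReal_le_one.2 (norm_deriv_le_of_lipschitz hψ)
  exact (mul_le_mul_left h1 _).trans_eq (one_mul _)

end Topological

section Smooth

variable [TopologicalSpace M] [ChartedSpace (EuclideanSpace ℝ (Fin d)) M] [IsManifold (𝓡 d) ∞ M]
  [RiemannianBundle (fun x : M ↦ TangentSpace (𝓡 d) x)]
  [IsContMDiffRiemannianBundle (𝓡 d) ∞ (EuclideanSpace ℝ (Fin d))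
      (fun x : M ↦ TangentSpace (𝓡 d) x)]

/-- The gradient of a smooth function is locally bounded, because it is controlled by the Euclidean
derivative in a chart. -/
theorem eventually_enorm_gradient_le {f : M → ℝ} (hf : ContMDiff (𝓡 d) 𝓘(ℝ, ℝ) ∞ f) (x : M) :
    ∃ C : ℝ≥0, ∀ᶠ y in 𝓝 x, ‖gradient d f y‖ₑ ≤ C := by
  have : IsManifold (𝓡 d) 1 M := IsManifold.of_le (n := ∞) (by simp)
  have : IsContinuousRiemannianBundle (EuclideanSpace ℝ (Fin d))
      (fun x : M ↦ TangentSpace (𝓡 d) x) := by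
    obtain ⟨g, hg, h⟩ := IsContMDiffRiemannianBundle.exists_contMDiff (IB := 𝓡 d) (n := ∞)
      (F := EuclideanSpace ℝ (Fin d)) (E := fun x : M ↦ TangentSpace (𝓡 d) x)
    exact ⟨g, hg.continuous, h⟩
  obtain ⟨C, C_pos, hC⟩ := eventually_norm_mfderiv_extChartAt_lt (𝓡 d) x
  set φ := extChartAt (𝓡 d) x
  set g : EuclideanSpace ℝ (Fin d) → ℝ := f ∘ φ.symm
  have htar : IsOpen φ.target := isOpen_extChartAt_target x
  have hg : ContDiffOn ℝ ∞ g φ.target := by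
    rw [← contMDiffOn_iff_contDiffOn]
    exact hf.comp_contMDiffOn (contMDiffOn_extChartAt_symm x)
  have hcont : ContinuousAt (fun y ↦ ‖fderiv ℝ g (φ y)‖) x := by
    have h1 : ContinuousAt (fderiv ℝ g) (φ x) :=
      (hg.continuousOn_fderiv_of_isOpen htar (by simp)).continuousAt
        (htar.mem_nhds (mem_extChartAt_target x))
    exact (ContinuousAt.comp (f := φ) h1 (continuousAt_extChartAt x)).norm
  set K := ‖fderiv ℝ g (φ x)‖ + 1
  have hK : ∀ᶠ y in 𝓝 x, ‖fderiv ℝ g (φ y)‖ < K := hcont.eventually_lt_const (by simp [K])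
  refine ⟨⟨K * C, by positivity⟩, ?_⟩
  filter_upwards [hC, hK, extChartAt_source_mem_nhds (I := 𝓡 d) x] with y hy1 hy2 hy3
  refine enorm_gradient_le_of_bound fun v ↦ ?_
  have hfg : f =ᶠ[𝓝 y] g ∘ φ := by
    filter_upwards [(isOpen_extChartAt_source (I := 𝓡 d) x).mem_nhds hy3] with z hz
    simp [g, φ.left_inv hz]
  have hgd : DifferentiableAt ℝ g (φ y) :=
    ((hg.differentiableOn (by simp)) _ (φ.map_source hy3)).differentiableAt
      (htar.mem_nhds (φ.map_source hy3))
  have hy3' : y ∈ (chartAt (EuclideanSpace ℝ (Fin d)) x).source := by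
    rwa [← extChartAt_source (𝓡 d)]
  have hφd := mdifferentiableAt_extChartAt (I := 𝓡 d) hy3'
  have hcomp : differential (d := d) f y v
      = fderiv ℝ g (φ y) (mfderiv (𝓡 d) 𝓘(ℝ, EuclideanSpace ℝ (Fin d)) φ y v) := by
    have h2 := mfderiv_comp y hgd.mdifferentiableAt hφd
    rw [differential, hfg.mfderiv_eq, h2]
    simp only [mfderiv_eq_fderiv]
    rfl
  rw [hcomp]
  refine (ContinuousLinearMap.le_opNorm (fderiv ℝ g (φ y)) _).trans ?_
  change _ ≤ K * C * ‖v‖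
  rw [mul_assoc]
  refine mul_le_mul hy2.le ?_ (norm_nonneg _) (by positivity)
  exact (ContinuousLinearMap.le_opNorm _ v).trans
    (mul_le_mul_of_nonneg_right hy1.le (norm_nonneg _))

end Smooth

/-- Along a `C^1` path, a function whose gradient is bounded by `C` varies by at most `C` times the
length of the path. -/
theorem edist_le_pathELength {M : Type*} [TopologicalSpace M]
    [ChartedSpace (EuclideanSpace ℝ (Fin d)) M]
    [RiemannianBundle (fun x : M ↦ TangentSpace (𝓡 d) x)] {f : M → ℝ}
    (hf : ContMDiff (𝓡 d) 𝓘(ℝ, ℝ) ∞ f) {C : ℝ≥0}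
    {γ : ℝ → M} (hγ : ContMDiffOn 𝓘(ℝ, ℝ) (𝓡 d) 1 γ (Icc 0 1))
    (hC : ∀ t ∈ Icc (0 : ℝ) 1, ‖gradient d f (γ t)‖ₑ ≤ C) :
    edist (f (γ 0)) (f (γ 1)) ≤ C * pathELength (𝓡 d) γ 0 1 := by
  have hfγ : ContMDiffOn 𝓘(ℝ, ℝ) 𝓘(ℝ, ℝ) 1 (f ∘ γ) (Icc 0 1) :=
    (hf.of_le (by simp)).comp_contMDiffOn hγ
  rw [edist_comm, edist_eq_enorm_sub]
  calc ‖(f ∘ γ) 1 - (f ∘ γ) 0‖ₑ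
      ≤ ∫⁻ t in Icc (0 : ℝ) 1, ‖derivWithin (f ∘ γ) (Icc 0 1) t‖ₑ := by
        apply enorm_sub_le_lintegral_derivWithin_Icc_of_contDiffOn_Icc _ zero_le_one
        rwa [← contMDiffOn_iff_contDiffOn]
    _ ≤ ∫⁻ t in Icc (0 : ℝ) 1, C * ‖mfderivWithin 𝓘(ℝ, ℝ) (𝓡 d) γ (Icc 0 1) t 1‖ₑ := by
        refine setLIntegral_mono' measurableSet_Icc fun t ht ↦ ?_
        have h1 : mfderivWithin 𝓘(ℝ, ℝ) 𝓘(ℝ, ℝ) (f ∘ γ) (Icc 0 1) t =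
            (mfderiv (𝓡 d) 𝓘(ℝ, ℝ) f (γ t)) ∘L (mfderivWithin 𝓘(ℝ, ℝ) (𝓡 d) γ (Icc 0 1) t) := by
          apply mfderiv_comp_mfderivWithin
          · exact hf.mdifferentiable (by simp) _
          · exact hγ.mdifferentiableOn one_ne_zero t ht
          · rw [uniqueMDiffWithinAt_iff_uniqueDiffWithinAt]
            exact uniqueDiffOn_Icc zero_lt_one t ht
        have h2 : derivWithin (f ∘ γ) (Icc 0 1) t = differential (d := d) f (γ t)
            (mfderivWithin 𝓘(ℝ, ℝ) (𝓡 d) γ (Icc 0 1) t 1) := by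
          rw [← fderivWithin_derivWithin, ← mfderivWithin_eq_fderivWithin, h1]
          rfl
        have h3 : ‖gradient d f (γ t)‖ ≤ C := by
          have := hC t ht
          rw [← ofReal_norm, ← ENNReal.ofReal_coe_nnreal] at this
          exact (ENNReal.ofReal_le_ofReal_iff C.2).1 this
        rw [h2, ← ofReal_norm, ← ofReal_norm, ← ENNReal.ofReal_coe_nnreal,
          ← ENNReal.ofReal_mul (NNReal.coe_nonneg C), Real.norm_eq_abs]
        exact ENNReal.ofReal_le_ofReal ((abs_differential_le f (γ t) _).trans (by gcongr))
    _ = C * pathELength (𝓡 d) γ 0 1 := by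
        rw [lintegral_const_mul' _ _ ENNReal.coe_ne_top,
          pathELength_eq_lintegral_mfderivWithin_Icc]

theorem relCapacity_le_energy [EMetricSpace M] [MeasurableSpace M]
    [ChartedSpace (EuclideanSpace ℝ (Fin d)) M]
    [RiemannianBundle (fun x : M ↦ TangentSpace (𝓡 d) x)] {μ : Measure M} {A Ω : Set M} {f : M → ℝ}
    (hf : LocallyLipschitz f) (hA : ∀ x ∈ A, 1 ≤ f x) (hΩ : ∀ x ∉ Ω, f x = 0) :
    relCapacity d μ A Ω ≤ energy d μ f :=
  iInf_le_of_le f (iInf_le_of_le hf (iInf_le_of_le hA (iInf_le _ hΩ)))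

theorem relCapacity_mono_left [EMetricSpace M] [MeasurableSpace M]
    [ChartedSpace (EuclideanSpace ℝ (Fin d)) M]
    [RiemannianBundle (fun x : M ↦ TangentSpace (𝓡 d) x)] {μ : Measure M} {A A' : Set M}
    (h : A' ⊆ A) (Ω : Set M) : relCapacity d μ A' Ω ≤ relCapacity d μ A Ω :=
  le_iInf fun _ ↦ le_iInf fun hf ↦ le_iInf fun h1 ↦ le_iInf fun h2 ↦
    relCapacity_le_energy hf (fun x hx ↦ h1 x (h hx)) h2

theorem capacity_le_relCapacity [EMetricSpace M] [MeasurableSpace M]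
    [ChartedSpace (EuclideanSpace ℝ (Fin d)) M]
    [RiemannianBundle (fun x : M ↦ TangentSpace (𝓡 d) x)] {μ : Measure M} {A Ω : Set M}
    (hΩ : MeasurableSet Ω) (hA : A ⊆ Ω) (h : μ Ω ≤ 1 / 2) :
    capacity d μ A ≤ relCapacity d μ A Ω :=
  iInf_le_of_le Ω (iInf_le_of_le hΩ (iInf_le_of_le hA (iInf_le _ h)))

section Metric

variable [EMetricSpace M]
  [ChartedSpace (EuclideanSpace ℝ (Fin d)) M] [IsManifold (𝓡 d) ∞ M]
  [RiemannianBundle (fun x : M ↦ TangentSpace (𝓡 d) x)]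
  [IsContMDiffRiemannianBundle (𝓡 d) ∞ (EuclideanSpace ℝ (Fin d))
      (fun x : M ↦ TangentSpace (𝓡 d) x)]
  [IsRiemannianManifold (𝓡 d) M]

/-- A smooth function is locally Lipschitz for the Riemannian distance: a path of length less than
`r` stays at distance less than `r` of its origin, so that the local bound on the gradient applies
along almost minimizing paths. -/
theorem locallyLipschitz_of_contMDiff {f : M → ℝ} (hf : ContMDiff (𝓡 d) 𝓘(ℝ, ℝ) ∞ f) :
    LocallyLipschitz f := by
  intro x
  obtain ⟨C, hC⟩ := eventually_enorm_gradient_le hf x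
  obtain ⟨r, hr, hball⟩ := EMetric.mem_nhds_iff.1 hC
  have hr2 : r / 2 ≠ 0 := (ENNReal.half_pos hr.ne').ne'
  refine ⟨C + 1, Metric.eball x (r / 2 / 2),
    Metric.eball_mem_nhds x (ENNReal.half_pos hr2), fun y hy z hz ↦ ?_⟩
  rw [Metric.mem_eball] at hy hz
  have hyz : edist y z < r / 2 :=
    calc edist y z ≤ edist y x + edist z x := edist_triangle_right _ _ _
      _ < r / 2 / 2 + r / 2 / 2 := ENNReal.add_lt_add hy hz
      _ = r / 2 := ENNReal.add_halves _
  rw [← ENNReal.div_le_iff' (by simp) ENNReal.coe_ne_top]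
  refine le_of_forall_gt_imp_ge_of_dense fun ρ hρ ↦ ?_
  rw [ENNReal.div_le_iff' (by simp) ENNReal.coe_ne_top]
  have hlt : riemannianEDist (𝓡 d) y z < min ρ (r / 2) := by
    rw [← IsRiemannianManifold.out]
    exact lt_min hρ hyz
  obtain ⟨γ, rfl, rfl, hγ, hlen⟩ := exists_lt_of_riemannianEDist_lt hlt
  refine (edist_le_pathELength hf (C := C) hγ fun t ht ↦ hball ?_).trans ?_
  · have h1 : edist (γ 0) (γ t) < r / 2 := by
      rw [IsRiemannianManifold.out (I := 𝓡 d)]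
      refine (riemannianEDist_le_pathELength (hγ.mono (Icc_subset_Icc_right ht.2)) rfl rfl
        ht.1).trans_lt ?_
      exact (pathELength_mono le_rfl ht.2).trans_lt (hlen.trans_le (min_le_right _ _))
    rw [Metric.mem_eball]
    calc edist (γ t) x ≤ edist (γ 0) (γ t) + edist (γ 0) x := edist_triangle_left _ _ _
      _ < r / 2 + r / 2 := ENNReal.add_lt_add h1 (hy.trans_le ENNReal.half_le_self)
      _ = r := ENNReal.add_halves _
  · gcongr
    · exact le_self_add
    · exact hlen.le.trans (min_le_left _ _)

/-- Every neighborhood of a point `x` contains the support of a smooth cut-off function of finite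
energy that equals `1` near `x`. -/
theorem exists_relCapacity_lt_top [MeasurableSpace M] (μ : Measure M)
    [IsFiniteMeasure μ] {x : M} {Ω : Set M} (hΩ : Ω ∈ 𝓝 x) :
    ∃ A : Set M, IsClosed A ∧ A ∈ 𝓝 x ∧ A ⊆ Ω ∧ relCapacity d μ A Ω < ⊤ := by
  obtain ⟨b, -, hb⟩ := (SmoothBumpFunction.nhds_basis_tsupport (I := 𝓡 d) x).mem_iff.1 hΩ
  have hsm : ContMDiff (𝓡 d) 𝓘(ℝ, ℝ) ∞ b := b.contMDiff
  refine ⟨{y | b y = 1}, isClosed_eq b.continuous continuous_const, b.eventuallyEq_one,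
    fun y hy ↦ hb (subset_tsupport _ ?_), ?_⟩
  · rw [Function.mem_support, hy]
    exact one_ne_zero
  obtain ⟨C, hC⟩ : ∃ C : ℝ≥0, ∀ y ∈ tsupport b, ‖gradient d b y‖ₑ ≤ C := by
    refine b.hasCompactSupport.isCompact.induction_on
      (p := fun s ↦ ∃ C : ℝ≥0, ∀ y ∈ s, ‖gradient d b y‖ₑ ≤ C) ⟨0, by simp⟩ ?_ ?_ ?_
    · rintro s t hst ⟨C, hC⟩
      exact ⟨C, fun y hy ↦ hC y (hst hy)⟩
    · rintro s t ⟨C, hC⟩ ⟨D, hD⟩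
      refine ⟨max C D, ?_⟩
      rintro y (hy | hy)
      · exact (hC y hy).trans (by simp)
      · exact (hD y hy).trans (by simp)
    · intro y _
      obtain ⟨C, hC⟩ := eventually_enorm_gradient_le hsm y
      exact ⟨_, mem_nhdsWithin_of_mem_nhds hC, C, fun z hz ↦ hz⟩
  have hC' : ∀ y, ‖gradient d b y‖ₑ ≤ C := fun y ↦ by
    by_cases hy : y ∈ tsupport b
    · exact hC y hy
    · rw [enorm_gradient_eq_zero_of_eventually_const (c := 0)]
      · exact bot_le
      · filter_upwards [(isClosed_tsupport b).isOpen_compl.mem_nhds hy] with z hz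
        exact image_eq_zero_of_notMem_tsupport hz
  calc relCapacity d μ {y | b y = 1} Ω ≤ energy d μ b := by
        refine relCapacity_le_energy (locallyLipschitz_of_contMDiff hsm) ?_ ?_
        · exact fun y hy ↦ hy.ge
        · exact fun y hy ↦ image_eq_zero_of_notMem_tsupport fun h ↦ hy (hb h)
    _ ≤ ∫⁻ _, (C : ℝ≥0∞) ^ 2 ∂μ := lintegral_mono fun y ↦ pow_le_pow_left' (hC' y) 2
    _ < ⊤ := by
        rw [lintegral_const]
        exact ENNReal.mul_lt_top (by simp) (measure_lt_top _ _)

end Metric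
end Geometry

/-! ### Measures without atoms and the capacity of sets of measure `1/2` -/

section NoAtoms

open Set Filter Topology

/-- A supremum of measures that do not charge the points does not charge the points, even if the
supremum is uncountable: removing a point from the supremum leaves an upper bound. -/
theorem nullSingletonClass_iSup {α ι : Type*} [MeasurableSpace α] [MeasurableSingletonClass α]
    (m : ι → Measure α) (h : ∀ i, NullSingletonClass (m i)) : NullSingletonClass (⨆ i, m i) := by
  refine ⟨fun x ↦ ?_⟩
  have := h
  have h1 : ⨆ i, m i ≤ (⨆ i, m i).restrict {x}ᶜ := by
    refine iSup_le fun i ↦ Measure.le_iff.2 fun s hs ↦ ?_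
    rw [Measure.restrict_apply hs, ← sdiff_eq_compl_inter.trans (inter_comm _ _),
      ← measure_sdiff_null (measure_singleton (μ := m i) x)]
    exact le_iSup m i _
  refine le_antisymm ((h1 _).trans ?_) bot_le
  rw [Measure.restrict_apply (measurableSet_singleton x)]
  simp

theorem nullSingletonClass_riemannianVolume {d : ℕ} (hd : 1 ≤ d) {M : Type*}
    [TopologicalSpace M] [T1Space M]
    [ChartedSpace (EuclideanSpace ℝ (Fin d)) M]
    [RiemannianBundle (fun x : M ↦ TangentSpace (𝓡 d) x)] [MeasurableSpace M] [BorelSpace M] :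
    NullSingletonClass (riemannianVolume d M) := by
  have : Nonempty (Fin d) := ⟨⟨0, hd⟩⟩
  refine nullSingletonClass_iSup _ fun p ↦ ⟨fun x ↦ ?_⟩
  rw [chartVolume_apply p (measurableSet_singleton x)]
  refine setLIntegral_measure_zero _ _ (Set.Subsingleton.measure_zero ?_ _)
  rintro y ⟨hy, hyx⟩ z ⟨hz, hzx⟩
  exact (chartAt (EuclideanSpace ℝ (Fin d)) p).symm.injOn hy hz
    ((mem_singleton_iff.1 hyx).trans (mem_singleton_iff.1 hzx).symm)

/-- Without atoms, a set of positive measure contains subsets of arbitrarily small positive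
measure. -/
theorem exists_measure_inter_pos_lt {α : Type*} [EMetricSpace α] [SecondCountableTopology α]
    [MeasurableSpace α] [BorelSpace α] {μ : Measure α} [IsFiniteMeasure μ] [NullSingletonClass μ]
    {A : Set α} (hA : μ A ≠ 0) {ε : ℝ≥0∞} (hε : 0 < ε) :
    ∃ U, MeasurableSet U ∧ 0 < μ (A ∩ U) ∧ μ U < ε := by
  obtain ⟨x, -, hx⟩ := exists_mem_forall_mem_nhdsWithin_pos_measure hA
  obtain ⟨U, hxU, hU, hlt⟩ := Set.exists_isOpen_lt_of_lt (μ := μ) ({x} : Set α) ε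
    (by simpa using hε)
  refine ⟨U, hU.measurableSet, hx _ ?_, hlt⟩
  exact inter_mem self_mem_nhdsWithin (mem_nhdsWithin_of_mem_nhds (hU.mem_nhds (hxU rfl)))

end NoAtoms

section Profile

open Set Filter Topology

variable {d : ℕ} {M : Type*} [EMetricSpace M] [SecondCountableTopology M]
    [ChartedSpace (EuclideanSpace ℝ (Fin d)) M]
    [RiemannianBundle (fun x : M ↦ TangentSpace (𝓡 d) x)]
    [MeasurableSpace M] [BorelSpace M] {μ : Measure M}

/-- If `b` were `0`, all sets of positive measure would have infinite capacity, whereas small balls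
have finite capacity. -/
theorem pos_of_forall_le_capacity [IsManifold (𝓡 d) ∞ M]
    [IsContMDiffRiemannianBundle (𝓡 d) ∞ (EuclideanSpace ℝ (Fin d))
      (fun x : M ↦ TangentSpace (𝓡 d) x)]
    [IsRiemannianManifold (𝓡 d) M] [IsProbabilityMeasure μ] [NullSingletonClass μ]
    {b k : ℝ≥0∞} (hk : k ≠ ⊤)
    (h : ∀ A : Set M, MeasurableSet A → μ A < 1 / 2 →
      1 / b * (μ A / (1 + k * μ A)) ≤ capacity d μ A) : 0 < b := by
  refine pos_iff_ne_zero.2 fun hb ↦ ?_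
  obtain ⟨x, -, hx⟩ := exists_mem_forall_mem_nhdsWithin_pos_measure (μ := μ) (s := univ) (by simp)
  obtain ⟨Ω, hxΩ, hΩ, hlt⟩ := Set.exists_isOpen_lt_of_lt (μ := μ) ({x} : Set M) (1 / 2) (by simp)
  obtain ⟨A, hA, hAx, hAΩ, hcap⟩ := exists_relCapacity_lt_top (d := d) μ (hΩ.mem_nhds (hxΩ rfl))
  have h0 : μ A ≠ 0 := (hx A (mem_nhdsWithin_of_mem_nhds hAx)).ne'
  have h1 := (h A hA.measurableSet ((measure_mono hAΩ).trans_lt hlt)).trans_lt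
    ((capacity_le_relCapacity hΩ.measurableSet hAΩ hlt.le).trans_lt hcap)
  rw [hb, ENNReal.div_zero one_ne_zero, ENNReal.top_mul] at h1
  · exact lt_irrefl _ h1
  · refine (ENNReal.div_pos h0 ?_).ne'
    finiteness

/-- The capacity inequality, assumed for sets of measure less than `1/2`, extends to the sets of
measure `1/2`: such a set is, up to an arbitrarily small measure, a set of smaller measure. -/
theorem profile_le_relCapacity [IsFiniteMeasure μ] [NullSingletonClass μ]
    {b k : ℝ≥0∞} (hb : b ≠ 0) (hb' : b ≠ ⊤) (hk : k ≠ ⊤)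
    (h : ∀ A : Set M, MeasurableSet A → μ A < 1 / 2 →
      1 / b * (μ A / (1 + k * μ A)) ≤ capacity d μ A)
    {A Ω : Set M} (hA : MeasurableSet A) (hΩ : MeasurableSet Ω) (hAΩ : A ⊆ Ω) (hμ : μ Ω ≤ 1 / 2) :
    μ A / (1 + k * μ A) ≤ b * relCapacity d μ A Ω := by
  have hne : 1 + k * μ A ≠ 0 := by simp
  have htop : 1 + k * μ A ≠ ⊤ := by finiteness
  have main : ∀ B, MeasurableSet B → B ⊆ A → μ B < 1 / 2 →
      μ B ≤ b * relCapacity d μ A Ω * (1 + k * μ A) := by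
    intro B hB hBA hlt
    have h1 : 1 / b * (μ B / (1 + k * μ B)) ≤ relCapacity d μ A Ω :=
      (h B hB hlt).trans ((capacity_le_relCapacity hΩ (hBA.trans hAΩ) hμ).trans
        (relCapacity_mono_left hBA Ω))
    rw [one_div, ENNReal.inv_mul_le_iff hb hb', ENNReal.div_le_iff (by simp) (by finiteness)] at h1
    refine h1.trans ?_
    gcongr
  rw [ENNReal.div_le_iff hne htop]
  rcases ((measure_mono hAΩ).trans hμ).lt_or_eq with hlt | heq
  · exact main A hA subset_rfl hlt
  · refine ENNReal.le_of_forall_pos_le_add fun ε hε _ ↦ ?_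
    obtain ⟨U, hU, hpos, hlt⟩ := exists_measure_inter_pos_lt (μ := μ) (A := A)
      (by rw [heq]; simp) (ENNReal.coe_pos.2 hε)
    have hsplit : μ (A ∩ U) + μ (A \ U) = μ A := measure_inter_add_sdiff A hU
    calc μ A = μ (A \ U) + μ (A ∩ U) := by rw [← hsplit, add_comm]
      _ ≤ _ := add_le_add (main _ (hA.diff hU) sdiff_subset ?_)
        ((measure_mono inter_subset_right).trans hlt.le)
    rw [← heq, ← hsplit, add_comm]
    exact ENNReal.lt_add_right (measure_ne_top _ _) hpos.ne'

end Profile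

/-! ### A discrete Hardy inequality and `C^1` ramps -/

section Hardy

open Finset

/-- A discrete Hardy inequality. The term `n² / R`, with `R` the sum of the `r j` for `j < n`, makes
the induction work: for `n ≥ 1` and `r = r n`, the difference of both sides increases by
`((2 R - n r)² + 2 R r) / (r R (R + r))` from `n` to `n + 1`. -/
theorem sum_odd_div_sum_le {r : ℕ → ℝ} (hr : ∀ j, 0 < r j) (n : ℕ) :
    ∑ k ∈ range n, (2 * k + 1 : ℝ) / ∑ j ∈ range (k + 1), r j + n ^ 2 / ∑ j ∈ range n, r j
      ≤ 4 * ∑ j ∈ range n, 1 / r j := by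
  induction n with
  | zero => simp
  | succ n ih =>
    rw [sum_range_succ, sum_range_succ (fun j ↦ 1 / r j), mul_add]
    set R := ∑ j ∈ range n, r j with hR
    have hRs : ∑ j ∈ range (n + 1), r j = R + r n := sum_range_succ _ _
    rw [hRs]
    have hrn := hr n
    have key : (2 * n + 1 : ℝ) / (R + r n) + ((n + 1 : ℕ) : ℝ) ^ 2 / (R + r n)
        ≤ n ^ 2 / R + 4 * (1 / r n) := by
      rcases Nat.eq_zero_or_pos n with rfl | hn
      · have h0 : R = 0 := by simp [hR]
        rw [h0]
        have : 0 < (r 0)⁻¹ := inv_pos.2 hrn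
        norm_num
        linarith
      · have hRpos : 0 < R := sum_pos (fun j _ ↦ hr j) ⟨0, by simpa using hn⟩
        have h1 : n ^ 2 / R + 4 * (1 / r n) - ((2 * n + 1 : ℝ) / (R + r n)
            + ((n + 1 : ℕ) : ℝ) ^ 2 / (R + r n))
            = ((2 * R - n * r n) ^ 2 + 2 * R * r n) / (r n * R * (R + r n)) := by
          push_cast
          field_simp
          ring
        have h2 : 0 ≤ ((2 * R - n * r n) ^ 2 + 2 * R * r n) / (r n * R * (R + r n)) := by
          positivity
        linarith
    linarith

end Hardy

section Ramp

open Set Filter Topology intervalIntegral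

/-- A `C^1` step from `0` to `1` on `[0, 1]`, flat near both ends, of slope at most `1 + η`: the
primitive of a bump that is constant on most of `[0, 1]`. -/
theorem exists_ramp {η : ℝ} (hη : 0 < η) :
    ∃ σ : ℝ → ℝ, ContDiff ℝ 1 σ ∧ (∃ a > 0, (∀ y ≤ a, σ y = 0) ∧ ∀ y, 1 - a ≤ y → σ y = 1) ∧
      ∀ y, |deriv σ y| ≤ 1 + η := by
  set i : ℝ := 1 / (2 * (1 + η)) with hi
  have hi0 : 0 < i := by positivity
  have hi1 : i < 1 / 2 := by
    rw [hi, div_lt_div_iff₀ (by positivity) (by positivity)]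
    linarith
  -- the normalized bump has height at most `1 / (2 i) = 1 + η`
  let b : ContDiffBump (1 / 2 : ℝ) :=
    { rIn := i, rOut := (i + 1 / 2) / 2, rIn_pos := hi0, rIn_lt_rOut := by linarith }
  set ρ : ℝ → ℝ := b.normed volume
  have hcont : Continuous ρ := b.continuous_normed
  set a : ℝ := 1 / 2 - (i + 1 / 2) / 2 with ha
  have ha0 : 0 < a := by linarith
  have hzero : ∀ y, y ∉ Ioo a (1 - a) → ρ y = 0 := by
    intro y hy
    have h1 : y ∉ Function.support ρ := by
      rw [b.support_normed_eq, Real.ball_eq_Ioo]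
      have e1 : (1 / 2 : ℝ) - b.rOut = a := rfl
      have e2 : (1 / 2 : ℝ) + b.rOut = 1 - a := by rw [← e1]; ring
      rwa [e1, e2]
    exact Function.notMem_support.1 h1
  have hderiv : ∀ y, HasDerivAt (fun y ↦ ∫ t in (0 : ℝ)..y, ρ t) (ρ y) y := fun y ↦
    integral_hasDerivAt_right (hcont.intervalIntegrable _ _)
      hcont.aestronglyMeasurable.stronglyMeasurableAtFilter hcont.continuousAt
  have hd : deriv (fun y ↦ ∫ t in (0 : ℝ)..y, ρ t) = ρ := funext fun y ↦ (hderiv y).deriv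
  refine ⟨fun y ↦ ∫ t in (0 : ℝ)..y, ρ t, ?_, ⟨a, ha0, fun y hy ↦ ?_, fun y hy ↦ ?_⟩, fun y ↦ ?_⟩
  · rw [contDiff_one_iff_deriv, hd]
    exact ⟨fun y ↦ (hderiv y).differentiableAt, hcont⟩
  · refine integral_zero_ae (Eventually.of_forall fun t ht ↦ hzero t fun h ↦ ?_)
    rcases mem_uIoc.1 ht with h' | h'
    · linarith [h.1, h'.2]
    · linarith [h.1, h'.2]
  · have h1 : Function.support ρ ⊆ Ioc 0 y := fun t ht ↦ by
      have := not_imp_comm.1 (hzero t) ht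
      exact ⟨by linarith [this.1], by linarith [this.2]⟩
    change ∫ t in (0 : ℝ)..y, ρ t = 1
    rw [integral_eq_integral_of_support_subset h1]
    exact b.integral_normed
  · rw [hd, abs_of_nonneg (b.nonneg_normed y)]
    refine (b.normed_le_div_measure_closedBall_rIn volume y).trans ?_
    rw [Real.volume_real_closedBall hi0.le]
    change 1 / (2 * i) ≤ 1 + η
    rw [hi]
    apply le_of_eq
    field_simp

/-- A `C^1` profile that climbs from `0` to `1` on `[0, k]`, with slope about `c j` on
`[j, j + 1]`. -/
theorem exists_profile {η : ℝ} (hη : 0 < η) {k : ℕ} {c : ℕ → ℝ} (hc : ∀ j, 0 ≤ c j)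
    (hsum : ∑ j ∈ Finset.range k, c j = 1) :
    ∃ H : ℝ → ℝ, ContDiff ℝ 1 H ∧ (∃ a > 0, (∀ y ≤ a, H y = 0) ∧ ∀ y, k - a ≤ y → H y = 1) ∧
      ∀ j < k, ∀ y ∈ Icc (j : ℝ) (j + 1), |deriv H y| ≤ (1 + η) * c j := by
  obtain ⟨σ, hσ, ⟨a, ha, h0, h1⟩, hd⟩ := exists_ramp hη
  have hd0 : ∀ y ≤ 0, deriv σ y = 0 := fun y hy ↦ by
    have : σ =ᶠ[𝓝 y] fun _ ↦ 0 := by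
      filter_upwards [eventually_lt_nhds (hy.trans_lt ha)] with z hz using h0 z hz.le
    rw [this.deriv_eq, deriv_const]
  have hd1 : ∀ y, 1 ≤ y → deriv σ y = 0 := fun y hy ↦ by
    have : σ =ᶠ[𝓝 y] fun _ ↦ 1 := by
      filter_upwards [eventually_gt_nhds (show 1 - a < y by linarith)] with z hz using h1 z hz.le
    rw [this.deriv_eq, deriv_const]
  have hdiff : ∀ y, HasDerivAt (fun y ↦ ∑ j ∈ Finset.range k, c j * σ (y - j))
      (∑ j ∈ Finset.range k, c j * deriv σ (y - j)) y := fun y ↦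
    HasDerivAt.fun_sum fun j _ ↦
      ((hσ.differentiable one_ne_zero (y - j)).hasDerivAt.comp_sub_const y (j : ℝ)).const_mul (c j)
  refine ⟨fun y ↦ ∑ j ∈ Finset.range k, c j * σ (y - j), ?_, ⟨a, ha, ?_, ?_⟩, ?_⟩
  · exact ContDiff.sum fun j _ ↦ contDiff_const.mul (hσ.comp (contDiff_id.sub contDiff_const))
  · intro y hy
    refine Finset.sum_eq_zero fun j _ ↦ ?_
    rw [h0, mul_zero]
    have : (0 : ℝ) ≤ j := j.cast_nonneg
    linarith
  · intro y hy
    rw [← hsum]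
    refine Finset.sum_congr rfl fun j hj ↦ ?_
    rw [h1, mul_one]
    have : (j + 1 : ℝ) ≤ k := mod_cast Finset.mem_range.1 hj
    linarith
  · intro j hj y hy
    rw [(hdiff y).deriv, Finset.sum_eq_single j]
    · rw [abs_mul, abs_of_nonneg (hc j), mul_comm]
      exact mul_le_mul_of_nonneg_right (hd _) (hc j)
    · intro i _ hij
      rcases hij.lt_or_gt with h | h
      · have : (i + 1 : ℝ) ≤ j := mod_cast h
        rw [hd1 _ (by linarith [hy.1]), mul_zero]
      · have : (j + 1 : ℝ) ≤ i := mod_cast h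
        rw [hd0 _ (by linarith [hy.2]), mul_zero]
    · exact fun h ↦ absurd (Finset.mem_range.2 hj) h

end Ramp

/-! ### Maz'ya's capacitary inequality -/

section Mazya

open Set Filter Topology

theorem pairwise_disjoint_preimage_Ioc {α : Type*} (v : α → ℝ) :
    Pairwise (Function.onFun Disjoint fun j : ℕ ↦ v ⁻¹' Ioc (j : ℝ) (j + 1)) := by
  refine (pairwise_disjoint_on _).2 fun i j hij ↦ Disjoint.preimage _ ?_
  rw [Ioc_disjoint_Ioc]
  have : (i + 1 : ℝ) ≤ j := mod_cast hij
  exact (min_le_left _ _).trans (this.trans (le_max_right _ _))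

variable {d : ℕ} {M : Type*} [EMetricSpace M] [ChartedSpace (EuclideanSpace ℝ (Fin d)) M]
    [RiemannianBundle (fun x : M ↦ TangentSpace (𝓡 d) x)]
    [MeasurableSpace M] [BorelSpace M] {μ : Measure M}

/-- The competitor is `H ∘ v`, with `H` a `C^1` profile of slope about `c j` on `[j, j + 1]`. -/
theorem relCapacity_le_sum {v : M → ℝ} (hv : LocallyLipschitz v) {ρ : M → ℝ≥0∞} {k : ℕ}
    (hd : ∀ x, 0 < v x → v x < k → MDifferentiableAt (𝓡 d) 𝓘(ℝ, ℝ) v x ∧ ‖gradient d v x‖ₑ ≤ ρ x)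
    {η : ℝ} (hη : 0 < η) {c : ℕ → ℝ} (hc : ∀ j, 0 ≤ c j) (hsum : ∑ j ∈ Finset.range k, c j = 1) :
    relCapacity d μ {x | (k : ℝ) ≤ v x} {x | 0 < v x} ≤
      ∑ j ∈ Finset.range k, ENNReal.ofReal (((1 + η) * c j) ^ 2) *
        ∫⁻ x in v ⁻¹' Ioc (j : ℝ) (j + 1), ρ x ^ 2 ∂μ := by
  obtain ⟨H, hH, ⟨a, ha, h0, h1⟩, hderiv⟩ := exists_profile hη hc hsum
  have hmeas : ∀ j : ℕ, MeasurableSet (v ⁻¹' Ioc (j : ℝ) (j + 1)) := fun j ↦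
    hv.continuous.measurable measurableSet_Ioc
  have hdisj := pairwise_disjoint_preimage_Ioc v
  set S := ⋃ j ∈ Finset.range k, v ⁻¹' Ioc (j : ℝ) (j + 1) with hS
  have hSm : MeasurableSet S := Finset.measurableSet_biUnion _ fun j _ ↦ hmeas j
  -- near a point where `v` vanishes or is at least `k`, the competitor is constant
  have hout : ∀ x, ¬ (0 < v x ∧ v x < k) → ‖gradient d (H ∘ v) x‖ₑ = 0 := by
    intro x hx
    rcases le_or_gt (v x) 0 with hx0 | hx0
    · refine enorm_gradient_eq_zero_of_eventually_const (c := 0) ?_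
      filter_upwards [hv.continuous.continuousAt.eventually_lt_const (hx0.trans_lt ha)] with y hy
        using h0 _ hy.le
    · have hxk : (k : ℝ) ≤ v x := not_lt.1 fun h ↦ hx ⟨hx0, h⟩
      refine enorm_gradient_eq_zero_of_eventually_const (c := 1) ?_
      filter_upwards [hv.continuous.continuousAt.eventually_const_lt
        (show (k : ℝ) - a < v x by linarith)] with y hy using h1 _ hy.le
  -- outside the slices `j < v ≤ j + 1`, `j < k`, the competitor has no energy
  have hcompl : ∀ x ∈ Sᶜ, ‖gradient d (H ∘ v) x‖ₑ ^ 2 = 0 := by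
    intro x hx
    rw [hout, zero_pow two_ne_zero]
    rintro ⟨hx0, hxk⟩
    refine hx (mem_iUnion₂.2 ⟨⌈v x⌉₊ - 1, ?_, ?_⟩)
    · have h2 : ⌈v x⌉₊ ≤ k := Nat.ceil_le.2 hxk.le
      have h3 : 0 < ⌈v x⌉₊ := Nat.ceil_pos.2 hx0
      exact Finset.mem_range.2 (by omega)
    · have h3 : 0 < ⌈v x⌉₊ := Nat.ceil_pos.2 hx0
      have h4 := Nat.ceil_lt_add_one hx0.le
      have h5 := Nat.le_ceil (v x)
      have h6 : ((⌈v x⌉₊ - 1 : ℕ) : ℝ) = ⌈v x⌉₊ - 1 := by rw [Nat.cast_sub h3, Nat.cast_one]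
      rw [mem_preimage, h6]
      exact ⟨by linarith, by linarith⟩
  have hin : ∀ j ∈ Finset.range k, ∀ x ∈ v ⁻¹' Ioc (j : ℝ) (j + 1),
      ‖gradient d (H ∘ v) x‖ₑ ^ 2 ≤ ENNReal.ofReal (((1 + η) * c j) ^ 2) * ρ x ^ 2 := by
    intro j hj x hx
    by_cases hx' : 0 < v x ∧ v x < k
    · obtain ⟨hdx, hle⟩ := hd x hx'.1 hx'.2
      rw [ENNReal.ofReal_pow (mul_nonneg (by positivity) (hc j)), ← mul_pow]
      refine pow_le_pow_left' ((enorm_gradient_comp_le (hH.differentiable one_ne_zero _) hdx).trans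
        (mul_le_mul' ?_ hle)) 2
      rw [← ofReal_norm, Real.norm_eq_abs]
      exact ENNReal.ofReal_le_ofReal
        (hderiv j (Finset.mem_range.1 hj) _ (Ioc_subset_Icc_self hx))
    · rw [hout x hx', zero_pow two_ne_zero]
      exact bot_le
  calc relCapacity d μ {x | (k : ℝ) ≤ v x} {x | 0 < v x} ≤ energy d μ (H ∘ v) := by
        refine relCapacity_le_energy ((hH.locallyLipschitz).comp hv) (fun x hx ↦ ?_) fun x hx ↦ ?_
        · exact (h1 _ (by have : (k : ℝ) ≤ v x := hx; linarith)).ge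
        · exact h0 _ ((not_lt.1 hx).trans ha.le)
    _ = ∫⁻ x in S, ‖gradient d (H ∘ v) x‖ₑ ^ 2 ∂μ := by
        rw [energy, ← lintegral_add_compl _ hSm, setLIntegral_congr_fun hSm.compl hcompl]
        simp
    _ = ∑ j ∈ Finset.range k, ∫⁻ x in v ⁻¹' Ioc (j : ℝ) (j + 1), ‖gradient d (H ∘ v) x‖ₑ ^ 2 ∂μ :=
        lintegral_biUnion_finset (fun i _ j _ hij ↦ hdisj hij) (fun j _ ↦ hmeas j) _
    _ ≤ _ := by
        refine Finset.sum_le_sum fun j hj ↦ ?_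
        rw [← lintegral_const_mul' _ _ ENNReal.ofReal_ne_top]
        exact setLIntegral_mono' (hmeas j) (hin j hj)

/-- The capacitary inequality for the integer levels. The profile of the competitor for the level
`k + 1` has slope proportional to `r j = 1 / γ j` on `[j, j + 1]`, with `γ j` the energy between the
levels `j` and `j + 1`; this gives the bound `1 / (r 0 + ⋯ + r k)` for the capacity, and the
discrete Hardy inequality sums these bounds. -/
theorem sum_measure_le {v : M → ℝ} (hv : LocallyLipschitz v) {ρ : M → ℝ≥0∞}
    (hd : ∀ x, 0 < v x → (∃ y, v x < v y) →
      MDifferentiableAt (𝓡 d) 𝓘(ℝ, ℝ) v x ∧ ‖gradient d v x‖ₑ ≤ ρ x)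
    {ν : Measure M} {B : ℝ≥0∞} (hB : B ≠ 0) (hB' : B ≠ ⊤)
    (h : ∀ t > 0, ν {x | t ≤ v x} ≤ B * relCapacity d μ {x | t ≤ v x} {x | 0 < v x}) (n : ℕ) :
    ∑ k ∈ Finset.range n, (2 * k + 1 : ℝ≥0∞) * ν {x | ((k + 1 : ℕ) : ℝ) ≤ v x}
      ≤ 4 * B * ∫⁻ x in {x | 0 < v x}, ρ x ^ 2 ∂μ := by
  set E := ∫⁻ x in {x | 0 < v x}, ρ x ^ 2 ∂μ with hE
  by_cases hEtop : E = ⊤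
  · rw [hEtop, ENNReal.mul_top (by simp [hB])]
    exact le_top
  set γ : ℕ → ℝ≥0∞ := fun j ↦ ∫⁻ x in v ⁻¹' Ioc (j : ℝ) (j + 1), ρ x ^ 2 ∂μ
  have hmeas : ∀ j : ℕ, MeasurableSet (v ⁻¹' Ioc (j : ℝ) (j + 1)) := fun j ↦
    hv.continuous.measurable measurableSet_Ioc
  have hdisj := pairwise_disjoint_preimage_Ioc v
  have hγE : ∑ j ∈ Finset.range n, γ j ≤ E := by
    rw [← lintegral_biUnion_finset (fun i _ j _ hij ↦ hdisj hij) (fun j _ ↦ hmeas j)]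
    refine lintegral_mono_set (iUnion₂_subset fun j _ x hx ↦ ?_)
    exact (Nat.cast_nonneg j).trans_lt hx.1
  have hγtop : ∀ j, γ j ≠ ⊤ := fun j ↦ ne_top_of_le_ne_top hEtop
    (lintegral_mono_set fun x hx ↦ (Nat.cast_nonneg j).trans_lt hx.1)
  have hγsum : ∑ j ∈ Finset.range n, (γ j).toReal ≤ E.toReal := by
    rw [← ENNReal.toReal_sum fun j _ ↦ hγtop j]
    exact ENNReal.toReal_mono hEtop hγE
  -- `η` bounds the excess slope of the ramps, and is added to the energies to make them positive
  have main : ∀ η > 0, ∑ k ∈ Finset.range n, (2 * k + 1 : ℝ≥0∞) * ν {x | ((k + 1 : ℕ) : ℝ) ≤ v x}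
      ≤ B * ENNReal.ofReal ((1 + η) ^ 2 * (4 * (E.toReal + n * η))) := by
    intro η hη
    set r : ℕ → ℝ := fun j ↦ 1 / ((γ j).toReal + η) with hr
    have hrpos : ∀ j, 0 < r j := fun j ↦ by positivity
    set R : ℕ → ℝ := fun k ↦ ∑ j ∈ Finset.range (k + 1), r j with hR
    have hRpos : ∀ k, 0 < R k := fun k ↦
      Finset.sum_pos (fun j _ ↦ hrpos j) (by simp)
    have hcap : ∀ k, ν {x | ((k + 1 : ℕ) : ℝ) ≤ v x} ≤ B * ENNReal.ofReal ((1 + η) ^ 2 / R k) := by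
      intro k
      rcases eq_empty_or_nonempty {x | ((k + 1 : ℕ) : ℝ) ≤ v x} with hemp | ⟨z, hz⟩
      · rw [hemp, measure_empty]
        exact bot_le
      refine (h _ (by positivity)).trans (mul_le_mul_right ?_ B)
      refine (relCapacity_le_sum hv (ρ := ρ) (fun x hx0 hx1 ↦ hd x hx0 ⟨z, hx1.trans_le hz⟩) hη
        (c := fun j ↦ r j / R k) (fun j ↦ div_nonneg (hrpos j).le (hRpos k).le) ?_).trans ?_
      · rw [← Finset.sum_div]
        exact div_self (hRpos k).ne'
      · calc ∑ j ∈ Finset.range (k + 1), ENNReal.ofReal (((1 + η) * (r j / R k)) ^ 2) * γ j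
            ≤ ∑ j ∈ Finset.range (k + 1), ENNReal.ofReal ((1 + η) ^ 2 / R k ^ 2 * r j) := by
              refine Finset.sum_le_sum fun j _ ↦ ?_
              rw [← ENNReal.ofReal_toReal (hγtop j), ← ENNReal.ofReal_mul (by positivity)]
              refine ENNReal.ofReal_le_ofReal ?_
              have h1 : r j * (γ j).toReal ≤ 1 := by
                rw [hr, one_div_mul_eq_div]
                exact div_le_one_of_le₀ (by linarith) (by positivity)
              calc ((1 + η) * (r j / R k)) ^ 2 * (γ j).toReal
                  = (1 + η) ^ 2 / R k ^ 2 * r j * (r j * (γ j).toReal) := by ring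
                _ ≤ (1 + η) ^ 2 / R k ^ 2 * r j * 1 := by
                    have := hrpos j
                    gcongr
                _ = _ := mul_one _
          _ = ENNReal.ofReal ((1 + η) ^ 2 / R k) := by
              rw [← ENNReal.ofReal_sum_of_nonneg fun j _ ↦ by have := hrpos j; positivity,
                ← Finset.mul_sum]
              congr 1
              change (1 + η) ^ 2 / R k ^ 2 * R k = _
              have := (hRpos k).ne'
              field_simp
    calc ∑ k ∈ Finset.range n, (2 * k + 1 : ℝ≥0∞) * ν {x | ((k + 1 : ℕ) : ℝ) ≤ v x}
        ≤ ∑ k ∈ Finset.range n, B * ENNReal.ofReal ((1 + η) ^ 2 * ((2 * k + 1) / R k)) := by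
          refine Finset.sum_le_sum fun k _ ↦ ?_
          have h2 : (2 * k + 1 : ℝ≥0∞) = ENNReal.ofReal (2 * k + 1) := by
            rw [ENNReal.ofReal_add (by positivity) zero_le_one, ENNReal.ofReal_mul zero_le_two]
            simp
          have h3 : (1 + η) ^ 2 * ((2 * k + 1) / R k) = (2 * k + 1) * ((1 + η) ^ 2 / R k) := by ring
          rw [h3, ENNReal.ofReal_mul (by positivity), ← h2, mul_left_comm]
          exact mul_le_mul_right (hcap k) _
      _ = B * ENNReal.ofReal ((1 + η) ^ 2 * ∑ k ∈ Finset.range n, (2 * k + 1) / R k) := by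
          rw [← Finset.mul_sum, Finset.mul_sum _ _ ((1 + η) ^ 2), ENNReal.ofReal_sum_of_nonneg]
          intro k _
          have := hRpos k
          positivity
      _ ≤ _ := by
          refine mul_le_mul_right (ENNReal.ofReal_le_ofReal ?_) B
          refine mul_le_mul_of_nonneg_left ?_ (by positivity)
          have h4 := sum_odd_div_sum_le hrpos n
          have h5 : 0 ≤ (n : ℝ) ^ 2 / ∑ j ∈ Finset.range n, r j :=
            div_nonneg (by positivity) (Finset.sum_nonneg fun j _ ↦ (hrpos j).le)
          have h6 : ∑ j ∈ Finset.range n, 1 / r j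
              = ∑ j ∈ Finset.range n, (γ j).toReal + n * η := by
            simp [hr, Finset.sum_add_distrib]
          linarith
  have hlim : Tendsto (fun η : ℝ ↦ B * ENNReal.ofReal ((1 + η) ^ 2 * (4 * (E.toReal + n * η))))
      (𝓝[>] 0) (𝓝 (B * ENNReal.ofReal ((1 + 0) ^ 2 * (4 * (E.toReal + n * 0))))) := by
    refine Tendsto.mono_left ?_ nhdsWithin_le_nhds
    refine ENNReal.Tendsto.const_mul (ENNReal.tendsto_ofReal ?_) (Or.inr hB')
    exact Continuous.tendsto (by fun_prop) _
  have hfin : B * ENNReal.ofReal ((1 + 0) ^ 2 * (4 * (E.toReal + n * 0))) = 4 * B * E := by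
    rw [mul_zero, add_zero, add_zero, one_pow, one_mul, ENNReal.ofReal_mul (by norm_num),
      ENNReal.ofReal_toReal hEtop, ENNReal.ofReal_ofNat]
    ring
  rw [← hfin]
  exact ge_of_tendsto hlim (eventually_nhdsWithin_of_forall main)

/-- Layer-cake form of the previous bounds: `⌊v⌋²` is the sum of the `2 k + 1` over the levels
`k + 1 ≤ v`. -/
theorem lintegral_floor_sq_le {v : M → ℝ} (hv : LocallyLipschitz v) {ρ : M → ℝ≥0∞}
    (hd : ∀ x, 0 < v x → (∃ y, v x < v y) →
      MDifferentiableAt (𝓡 d) 𝓘(ℝ, ℝ) v x ∧ ‖gradient d v x‖ₑ ≤ ρ x)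
    {ν : Measure M} {B : ℝ≥0∞} (hB : B ≠ 0) (hB' : B ≠ ⊤)
    (h : ∀ t > 0, ν {x | t ≤ v x} ≤ B * relCapacity d μ {x | t ≤ v x} {x | 0 < v x}) :
    ∫⁻ x, (⌊v x⌋₊ : ℝ≥0∞) ^ 2 ∂ν ≤ 4 * B * ∫⁻ x in {x | 0 < v x}, ρ x ^ 2 ∂μ := by
  have hmeas : ∀ k : ℕ, MeasurableSet {x | ((k + 1 : ℕ) : ℝ) ≤ v x} := fun k ↦
    hv.continuous.measurable measurableSet_Ici
  have hodd : ∀ N : ℕ, ∑ k ∈ Finset.range N, (2 * k + 1 : ℝ≥0∞) = (N : ℝ≥0∞) ^ 2 := by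
    intro N
    induction N with
    | zero => simp
    | succ N ih =>
      rw [Finset.sum_range_succ, ih]
      push_cast
      ring
  have hlayer : ∀ x, (⌊v x⌋₊ : ℝ≥0∞) ^ 2
      ≤ ∑' k : ℕ, {x | ((k + 1 : ℕ) : ℝ) ≤ v x}.indicator (fun _ ↦ (2 * k + 1 : ℝ≥0∞)) x := by
    intro x
    rw [← hodd]
    refine le_trans (Finset.sum_le_sum fun k hk ↦ ?_) (ENNReal.sum_le_tsum (Finset.range ⌊v x⌋₊))
    rw [indicator_of_mem]
    exact (Nat.le_floor_iff' k.succ_ne_zero).1 (Finset.mem_range.1 hk)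
  calc ∫⁻ x, (⌊v x⌋₊ : ℝ≥0∞) ^ 2 ∂ν
      ≤ ∫⁻ x, ∑' k : ℕ,
          {x | ((k + 1 : ℕ) : ℝ) ≤ v x}.indicator (fun _ ↦ (2 * k + 1 : ℝ≥0∞)) x ∂ν :=
        lintegral_mono hlayer
    _ = ∑' k : ℕ, (2 * k + 1 : ℝ≥0∞) * ν {x | ((k + 1 : ℕ) : ℝ) ≤ v x} := by
        rw [lintegral_tsum fun k ↦ (measurable_const.indicator (hmeas k)).aemeasurable]
        exact tsum_congr fun k ↦ lintegral_indicator_const (hmeas k) _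
    _ ≤ _ := ENNReal.tsum_le_of_sum_range_le fun n ↦ sum_measure_le hv hd hB hB' h n

/-- Maz'ya's capacitary inequality, with its sharp constant: if `B` times the capacity of the
superlevel sets `{t ≤ u}` dominates their `ν`-measure, then `∫ u² dν` is at most `4 B` times the
energy of `u`. The function `ρ` bounds the gradient of `u`. No differentiability is asked where `u`
vanishes or is maximal, since the competitors are constant there. -/
theorem lintegral_sq_le_of_capacity {u : M → ℝ} (hu : LocallyLipschitz u) (hu0 : ∀ x, 0 ≤ u x)
    {ρ : M → ℝ≥0∞} (hd : ∀ x, 0 < u x → (∃ y, u x < u y) →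
      MDifferentiableAt (𝓡 d) 𝓘(ℝ, ℝ) u x ∧ ‖gradient d u x‖ₑ ≤ ρ x)
    {ν : Measure M} {B : ℝ≥0∞} (hB : B ≠ 0) (hB' : B ≠ ⊤)
    (h : ∀ t > 0, ν {x | t ≤ u x} ≤ B * relCapacity d μ {x | t ≤ u x} {x | 0 < u x}) :
    ∫⁻ x, ENNReal.ofReal (u x) ^ 2 ∂ν ≤ 4 * B * ∫⁻ x in {x | 0 < u x}, ρ x ^ 2 ∂μ := by
  -- apply the integer version to `n u`, and let `n` tend to infinity
  have main : ∀ n : ℕ, 0 < n → ∫⁻ x, ENNReal.ofReal (⌊u x * n⌋₊ / n) ^ 2 ∂ν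
      ≤ 4 * B * ∫⁻ x in {x | 0 < u x}, ρ x ^ 2 ∂μ := by
    intro n hn
    have hn' : (0 : ℝ) < n := mod_cast hn
    have hne : (n : ℝ≥0∞) ≠ 0 := mod_cast hn.ne'
    set H : ℝ → ℝ := fun y ↦ y * n with hH
    have hHd : ∀ y, HasDerivAt H n y := fun y ↦ by simpa using (hasDerivAt_id y).mul_const (n : ℝ)
    have hHl : LocallyLipschitz H :=
      (contDiff_id.mul contDiff_const : ContDiff ℝ 1 H).locallyLipschitz
    have h0 : {x | 0 < (H ∘ u) x} = {x | 0 < u x} := by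
      ext x
      exact mul_pos_iff_of_pos_right hn'
    have key := lintegral_floor_sq_le (v := H ∘ u) (hHl.comp hu) (ρ := fun x ↦ n * ρ x) (μ := μ)
      (d := d) (ν := ν) (fun x hx ⟨y, hy⟩ ↦ ?_) hB hB' (fun t ht ↦ ?_)
    · calc ∫⁻ x, ENNReal.ofReal (⌊u x * n⌋₊ / n) ^ 2 ∂ν
          = ((n : ℝ≥0∞) ^ 2)⁻¹ * ∫⁻ x, (⌊(H ∘ u) x⌋₊ : ℝ≥0∞) ^ 2 ∂ν := by
            rw [← lintegral_const_mul' _ _ (by simp [hne])]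
            congr 1 with x
            rw [ENNReal.ofReal_div_of_pos hn', ENNReal.ofReal_natCast, ENNReal.ofReal_natCast,
              div_eq_mul_inv, mul_pow, mul_comm, ENNReal.inv_pow]
            rfl
        _ ≤ ((n : ℝ≥0∞) ^ 2)⁻¹ * (4 * B * ∫⁻ x in {x | 0 < u x}, (n * ρ x) ^ 2 ∂μ) := by
            rw [h0] at key
            gcongr
        _ = (((n : ℝ≥0∞) ^ 2)⁻¹ * n ^ 2) * (4 * B * ∫⁻ x in {x | 0 < u x}, ρ x ^ 2 ∂μ) := by
            simp_rw [mul_pow]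
            rw [lintegral_const_mul' _ _ (by simp)]
            ring
        _ = _ := by
            rw [ENNReal.inv_mul_cancel (by simp [hne]) (by simp), one_mul]
    · obtain ⟨h1, h2⟩ := hd x ((mul_pos_iff_of_pos_right hn').1 hx)
        ⟨y, (mul_lt_mul_iff_left₀ hn').1 hy⟩
      refine ⟨(hHd _).differentiableAt.mdifferentiableAt.comp x h1, ?_⟩
      refine (enorm_gradient_comp_le (hHd _).differentiableAt h1).trans ?_
      rw [(hHd _).deriv]
      refine mul_le_mul' (le_of_eq ?_) h2
      rw [← ofReal_norm, Real.norm_natCast, ENNReal.ofReal_natCast]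
    · have h1 : {x | t ≤ (H ∘ u) x} = {x | t / n ≤ u x} := by
        ext x
        exact (div_le_iff₀ hn').symm
      rw [h0, h1]
      exact h _ (by positivity)
  have hlim : ∀ x, Tendsto (fun n : ℕ ↦ ENNReal.ofReal (⌊u x * n⌋₊ / n) ^ 2) atTop
      (𝓝 (ENNReal.ofReal (u x) ^ 2)) := fun x ↦
    ENNReal.Tendsto.pow (ENNReal.tendsto_ofReal
      ((tendsto_nat_floor_mul_div_atTop (hu0 x)).comp tendsto_natCast_atTop_atTop))
  calc ∫⁻ x, ENNReal.ofReal (u x) ^ 2 ∂ν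
      = ∫⁻ x, liminf (fun n : ℕ ↦ ENNReal.ofReal (⌊u x * n⌋₊ / n) ^ 2) atTop ∂ν := by
        congr 1 with x
        exact (hlim x).liminf_eq.symm
    _ ≤ liminf (fun n : ℕ ↦ ∫⁻ x, ENNReal.ofReal (⌊u x * n⌋₊ / n) ^ 2 ∂ν) atTop := by
        refine lintegral_liminf_le fun n ↦ ?_
        have := hu.continuous.measurable
        fun_prop
    _ ≤ _ := by
        refine liminf_le_of_frequently_le' (Eventually.frequently ?_)
        filter_upwards [eventually_gt_atTop 0] with n hn using main n hn

end Mazya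

/-! ### The weight, and the parts above and below a median -/

section Weight

open Set Filter Topology

variable {α : Type*} [MeasurableSpace α] {μ : Measure α}

/-- The weight `g = u / (c + u)`, as a density. For `c = k ∫ u`, the integral of `u² (1 - g)` is at
most `k (∫ u)²`, while the mass of a set `A` is at most `μ A / (1 + k μ A)`. Where `u` vanishes, the
weight is `0`. -/
def weight (c : ℝ) (u : α → ℝ) (x : α) : ℝ≥0∞ :=
  ENNReal.ofReal (u x / (c + u x))

theorem lintegral_sq_le_weight {u : α → ℝ} (hu : Measurable u) (hu0 : ∀ x, 0 ≤ u x) {c : ℝ}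
    (hc : 0 ≤ c) :
    ∫⁻ x, ENNReal.ofReal (u x) ^ 2 ∂μ ≤
      ∫⁻ x, ENNReal.ofReal (u x) ^ 2 ∂(μ.withDensity (weight c u))
        + ENNReal.ofReal c * ∫⁻ x, ENNReal.ofReal (u x) ∂μ := by
  have hw : Measurable (weight c u) := by unfold weight; fun_prop
  rw [lintegral_withDensity_eq_lintegral_mul _ hw (by fun_prop),
    ← lintegral_const_mul _ (by fun_prop), ← lintegral_add_left (by fun_prop)]
  refine lintegral_mono fun x ↦ ?_
  simp only [Pi.mul_apply, weight]
  have h1 := hu0 x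
  rw [← ENNReal.ofReal_pow h1, ← ENNReal.ofReal_mul (by positivity), ← ENNReal.ofReal_mul hc,
    ← ENNReal.ofReal_add (by positivity) (by positivity)]
  refine ENNReal.ofReal_le_ofReal ?_
  rcases h1.eq_or_lt with h2 | h2
  · simp [← h2]
  · have h3 : u x ^ 2 = u x / (c + u x) * u x ^ 2 + c * u x * (u x / (c + u x)) := by
      field_simp
      ring
    have h4 : u x / (c + u x) ≤ 1 := div_le_one_of_le₀ (by linarith) (by linarith)
    have h5 : c * u x * (u x / (c + u x)) ≤ c * u x * 1 := by gcongr
    linarith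

/-- The concave function `u ↦ u / (c + u)` is bounded by its tangents. -/
theorem div_add_le_tangent {c u θ : ℝ} (hc : 0 < c) (hu : 0 ≤ u) :
    u / (c + u) ≤ (1 - θ) ^ 2 + θ ^ 2 * u / c := by
  have h1 : (1 - θ) ^ 2 + θ ^ 2 * u / c - u / (c + u) = (c - θ * (c + u)) ^ 2 / (c * (c + u)) := by
    field_simp
    ring
  have h2 : 0 ≤ (c - θ * (c + u)) ^ 2 / (c * (c + u)) := by positivity
  linarith

/-- With `c = k ∫ u`, the weight of every set `A` is at most `μ A / (1 + k μ A)`: integrate the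
tangent bound on `A`, with the optimal `θ = k μ A / (1 + k μ A)`. -/
theorem withDensity_weight_le [IsFiniteMeasure μ] {u : α → ℝ} (hu0 : ∀ x, 0 ≤ u x)
    {k : ℝ} (hk : 0 < k) (hI0 : ∫⁻ x, ENNReal.ofReal (u x) ∂μ ≠ 0)
    (hI : ∫⁻ x, ENNReal.ofReal (u x) ∂μ ≠ ⊤) {A : Set α} (hA : MeasurableSet A) :
    μ.withDensity (weight (k * (∫⁻ x, ENNReal.ofReal (u x) ∂μ).toReal) u) A
      ≤ μ A / (1 + ENNReal.ofReal k * μ A) := by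
  set I := (∫⁻ x, ENNReal.ofReal (u x) ∂μ).toReal with hIdef
  have hIpos : 0 < I := ENNReal.toReal_pos hI0 hI
  rw [withDensity_apply _ hA]
  set m := (μ A).toReal with hm
  have hm0 : 0 ≤ m := ENNReal.toReal_nonneg
  have hμA : μ A = ENNReal.ofReal m := (ENNReal.ofReal_toReal (measure_ne_top μ A)).symm
  set θ := k * m / (1 + k * m) with hθ
  have hθ1 : 0 ≤ θ := by positivity
  have hcpos : 0 < k * I := mul_pos hk hIpos
  calc ∫⁻ x in A, weight (k * I) u x ∂μ
      ≤ ∫⁻ x in A, (ENNReal.ofReal ((1 - θ) ^ 2)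
          + ENNReal.ofReal (θ ^ 2 / (k * I)) * ENNReal.ofReal (u x)) ∂μ := by
        refine lintegral_mono fun x ↦ ?_
        have := hu0 x
        rw [weight, ← ENNReal.ofReal_mul (by positivity),
          ← ENNReal.ofReal_add (by positivity) (by positivity)]
        refine ENNReal.ofReal_le_ofReal
          ((div_add_le_tangent (θ := θ) hcpos this).trans (le_of_eq ?_))
        ring
    _ = ENNReal.ofReal ((1 - θ) ^ 2) * μ A
          + ENNReal.ofReal (θ ^ 2 / (k * I)) * ∫⁻ x in A, ENNReal.ofReal (u x) ∂μ := by
        rw [lintegral_add_left measurable_const, lintegral_const_mul' _ _ ENNReal.ofReal_ne_top]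
        simp
    _ ≤ ENNReal.ofReal ((1 - θ) ^ 2) * μ A
          + ENNReal.ofReal (θ ^ 2 / (k * I)) * ∫⁻ x, ENNReal.ofReal (u x) ∂μ := by
        gcongr
        exact Measure.restrict_le_self
    _ = ENNReal.ofReal ((1 - θ) ^ 2 * m + θ ^ 2 / (k * I) * I) := by
        rw [hμA, ← ENNReal.ofReal_toReal hI, ← hIdef, ← ENNReal.ofReal_mul (by positivity),
          ← ENNReal.ofReal_mul (by positivity),
          ← ENNReal.ofReal_add (by positivity) (by positivity)]
    _ = ENNReal.ofReal (m / (1 + k * m)) := by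
        congr 1
        rw [hθ]
        field_simp
        ring
    _ = μ A / (1 + ENNReal.ofReal k * μ A) := by
        rw [ENNReal.ofReal_div_of_pos (by positivity), hμA,
          ENNReal.ofReal_add zero_le_one (by positivity), ENNReal.ofReal_mul hk.le,
          ENNReal.ofReal_one]

end Weight

section Median

open Set Filter Topology

variable {α : Type*} [MeasurableSpace α] {μ : Measure α} [IsProbabilityMeasure μ]

theorem exists_median {F : α → ℝ} (hF : Measurable F) (hF0 : ∀ x, 0 ≤ F x) :
    ∃ m, 0 ≤ m ∧ μ {x | m < F x} ≤ 1 / 2 ∧ μ {x | F x < m} ≤ 1 / 2 := by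
  set T : Set ℝ := {t | 0 ≤ t ∧ μ {x | t < F x} ≤ 1 / 2} with hT
  have hbdd : BddBelow T := ⟨0, fun t ht ↦ ht.1⟩
  have hne : T.Nonempty := by
    have h1 : Tendsto (fun n : ℕ ↦ μ {x | (n : ℝ) < F x}) atTop
        (𝓝 (μ (⋂ n : ℕ, {x | (n : ℝ) < F x}))) := by
      refine tendsto_measure_iInter_atTop
        (fun n ↦ (hF measurableSet_Ioi).nullMeasurableSet) ?_ ⟨0, measure_ne_top _ _⟩
      intro n k hnk x hx
      exact (Nat.cast_le.2 hnk).trans_lt (show (k : ℝ) < F x from hx)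
    have h2 : ⋂ n : ℕ, {x | (n : ℝ) < F x} = ∅ := by
      refine eq_empty_of_forall_notMem fun x hx ↦ ?_
      obtain ⟨n, hn⟩ := exists_nat_ge (F x)
      exact absurd (mem_iInter.1 hx n) (not_lt.2 hn)
    rw [h2, measure_empty] at h1
    obtain ⟨n, hn⟩ := (h1.eventually_lt_const (show (0 : ℝ≥0∞) < 1 / 2 by simp)).exists
    exact ⟨n, n.cast_nonneg, hn.le⟩
  have hm0 : 0 ≤ sInf T := le_csInf hne fun t ht ↦ ht.1
  refine ⟨sInf T, hm0, ?_, ?_⟩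
  · obtain ⟨t, htanti, htlim, htT⟩ := exists_seq_tendsto_sInf hne hbdd
    have h1 : {x | sInf T < F x} = ⋃ n, {x | t n < F x} := by
      ext x
      simp only [mem_ofPred_eq, mem_iUnion]
      refine ⟨fun h ↦ (htlim.eventually_lt_const h).exists, fun ⟨n, hn⟩ ↦ ?_⟩
      exact (csInf_le hbdd (htT n)).trans_lt hn
    have h2 : Monotone fun n ↦ {x | t n < F x} := fun n k hnk x hx ↦
      (htanti hnk).trans_lt hx
    rw [h1, h2.measure_iUnion]
    exact iSup_le fun n ↦ (htT n).2
  · have h1 : {x | F x < sInf T} = ⋃ n : ℕ, {x | F x ≤ sInf T - 1 / (n + 1)} := by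
      ext x
      simp only [mem_ofPred_eq, mem_iUnion]
      constructor
      · intro h
        obtain ⟨n, hn⟩ := exists_nat_one_div_lt (sub_pos.2 h)
        exact ⟨n, by linarith⟩
      · rintro ⟨n, hn⟩
        have : (0 : ℝ) < 1 / (n + 1) := by positivity
        linarith
    have h2 : Monotone fun n : ℕ ↦ {x | F x ≤ sInf T - 1 / (n + 1)} := fun n k hnk x hx ↦ by
      have : (1 : ℝ) / (k + 1) ≤ 1 / (n + 1) := by gcongr
      exact (show F x ≤ _ from hx).trans (by linarith)
    rw [h1, h2.measure_iUnion]
    refine iSup_le fun n ↦ ?_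
    set t := sInf T - 1 / (n + 1) with ht
    rcases lt_or_ge t 0 with h0 | h0
    · have : {x | F x ≤ t} = ∅ := eq_empty_of_forall_notMem fun x hx ↦
        absurd (h0.trans_le (hF0 x)) (not_lt.2 hx)
      rw [this, measure_empty]
      exact bot_le
    · have h3 : t ∉ T := fun h ↦ by
        have h4 := csInf_le hbdd h
        have : (0 : ℝ) < 1 / (n + 1) := by positivity
        linarith
      have h4 : 1 / 2 ≤ μ {x | t < F x} := le_of_lt (not_le.1 fun h ↦ h3 ⟨h0, h⟩)
      have h5 : {x | F x ≤ t} = {x | t < F x}ᶜ := by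
        ext x
        simp
      have hmeas : MeasurableSet {x | t < F x} := hF measurableSet_Ioi
      rw [h5, prob_compl_eq_one_sub hmeas, tsub_le_iff_right]
      calc (1 : ℝ≥0∞) = 1 / 2 + 1 / 2 := (ENNReal.add_halves 1).symm
        _ ≤ _ := by gcongr

/-- Recombination of the parts of `F` above and below a median `m`. The
variance of `F` is at most `∫ (F - m)²`, and `(∫ F)²` is at least the sum of the squares of the
integrals of the two parts, since `∫ F ≥ ∫ (F - m)⁺ + m / 2` and `∫ (F - m)⁻ ≤ m / 2`. -/
theorem lintegral_sq_le_of_parts {F : α → ℝ} (hF : Measurable F) (hF0 : ∀ x, 0 ≤ F x) {m : ℝ}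
    (hm : 0 ≤ m) (h2 : μ {x | F x < m} ≤ 1 / 2)
    {k : ℝ} (hk : 0 ≤ k) {a b c : ℝ≥0∞} (hab : a + b ≤ c)
    (ha : ∫⁻ x, ENNReal.ofReal (F x - m) ^ 2 ∂μ ≤
      a + ENNReal.ofReal k * (∫⁻ x, ENNReal.ofReal (F x - m) ∂μ) ^ 2)
    (hb : ∫⁻ x, ENNReal.ofReal (m - F x) ^ 2 ∂μ ≤
      b + ENNReal.ofReal k * (∫⁻ x, ENNReal.ofReal (m - F x) ∂μ) ^ 2) :
    ∫⁻ x, ENNReal.ofReal (F x) ^ 2 ∂μ ≤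
      c + ENNReal.ofReal (1 + k) * (∫⁻ x, ENNReal.ofReal (F x) ∂μ) ^ 2 := by
  set P := ∫⁻ x, ENNReal.ofReal (F x - m) ∂μ
  set N := ∫⁻ x, ENNReal.ofReal (m - F x) ∂μ
  set I := ∫⁻ x, ENNReal.ofReal (F x) ∂μ
  set m' := ENNReal.ofReal m with hm'
  -- all terms are moved to the side where they are positive, so that no integral needs to be finite
  have hvar : ∫⁻ x, ENNReal.ofReal (F x) ^ 2 ∂μ ≤ ∫⁻ x, ENNReal.ofReal (F x - m) ^ 2 ∂μ
      + ∫⁻ x, ENNReal.ofReal (m - F x) ^ 2 ∂μ + I ^ 2 := by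
    have hpt : ∀ x, ENNReal.ofReal (F x) ^ 2 + m' ^ 2 = ENNReal.ofReal (F x - m) ^ 2
        + ENNReal.ofReal (m - F x) ^ 2 + 2 * m' * ENNReal.ofReal (F x) := by
      intro x
      have h0 := hF0 x
      have h3 : 2 * m' * ENNReal.ofReal (F x) = ENNReal.ofReal (2 * m * F x) := by
        rw [ENNReal.ofReal_mul (by positivity), ENNReal.ofReal_mul zero_le_two,
          ENNReal.ofReal_ofNat]
      rw [h3, hm', ← ENNReal.ofReal_pow h0, ← ENNReal.ofReal_pow hm,
        ← ENNReal.ofReal_add (by positivity) (by positivity)]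
      rcases le_total (F x) m with h | h
      · rw [ENNReal.ofReal_of_nonpos (sub_nonpos.2 h), ← ENNReal.ofReal_pow (sub_nonneg.2 h),
          zero_pow two_ne_zero, zero_add, ← ENNReal.ofReal_add (by positivity) (by positivity)]
        congr 1
        ring
      · rw [ENNReal.ofReal_of_nonpos (sub_nonpos.2 h), ← ENNReal.ofReal_pow (sub_nonneg.2 h),
          zero_pow two_ne_zero, add_zero, ← ENNReal.ofReal_add (by positivity) (by positivity)]
        congr 1
        ring
    have hint : ∫⁻ x, ENNReal.ofReal (F x) ^ 2 ∂μ + m' ^ 2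
        = ∫⁻ x, ENNReal.ofReal (F x - m) ^ 2 ∂μ + ∫⁻ x, ENNReal.ofReal (m - F x) ^ 2 ∂μ
          + 2 * m' * I := by
      rw [← lintegral_const_mul _ (by fun_prop), ← lintegral_add_left (by fun_prop),
        ← lintegral_add_left (by fun_prop), ← lintegral_congr hpt,
        lintegral_add_left (by fun_prop)]
      simp
    have hamgm : 2 * m' * I ≤ I ^ 2 + m' ^ 2 := by
      by_cases hI : I = ⊤
      · simp [hI]
      · rw [← ENNReal.ofReal_toReal hI, hm', ← ENNReal.ofReal_pow hm,
          ← ENNReal.ofReal_pow ENNReal.toReal_nonneg, ← ENNReal.ofReal_ofNat,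
          ← ENNReal.ofReal_mul zero_le_two, ← ENNReal.ofReal_mul (by positivity),
          ← ENNReal.ofReal_add (by positivity) (by positivity)]
        exact ENNReal.ofReal_le_ofReal (by linarith [two_mul_le_add_sq m I.toReal])
    refine ENNReal.le_of_add_le_add_right (a := m' ^ 2) (by simp [m']) ?_
    rw [hint, add_assoc _ (I ^ 2)]
    gcongr
  have hN : N ≤ m' * (1 / 2) := by
    calc N ≤ ∫⁻ x, {x | F x < m}.indicator (fun _ ↦ m') x ∂μ := by
          refine lintegral_mono fun x ↦ ?_
          by_cases h : F x < m
          · rw [indicator_of_mem (show x ∈ {x | F x < m} from h)]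
            exact ENNReal.ofReal_le_ofReal (by linarith [hF0 x])
          · rw [ENNReal.ofReal_of_nonpos (by linarith)]
            exact bot_le
      _ = m' * μ {x | F x < m} := lintegral_indicator_const (hF measurableSet_Iio) _
      _ ≤ _ := by gcongr
  have hP : P + m' * (1 / 2) ≤ I := by
    have h3 : {x | F x < m} = {x | m ≤ F x}ᶜ := by
      ext x
      simp
    have hmeas : MeasurableSet {x | m ≤ F x} := hF measurableSet_Ici
    have h4 : 1 / 2 ≤ μ {x | m ≤ F x} := by
      have h5 : (1 : ℝ≥0∞) ≤ 1 / 2 + μ {x | m ≤ F x} := by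
        rwa [h3, prob_compl_eq_one_sub hmeas, tsub_le_iff_right] at h2
      refine ENNReal.le_of_add_le_add_left (a := 1 / 2) (by simp) ?_
      rwa [ENNReal.add_halves]
    calc P + m' * (1 / 2) ≤ P + m' * μ {x | m ≤ F x} := by gcongr
      _ = ∫⁻ x, (ENNReal.ofReal (F x - m) + {x | m ≤ F x}.indicator (fun _ ↦ m') x) ∂μ := by
          rw [lintegral_add_left (by fun_prop), lintegral_indicator_const hmeas]
      _ ≤ I := by
          refine lintegral_mono fun x ↦ ?_
          by_cases h : m ≤ F x
          · rw [indicator_of_mem (show x ∈ {x | m ≤ F x} from h),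
              ← ENNReal.ofReal_add (sub_nonneg.2 h) hm, sub_add_cancel]
          · rw [indicator_of_notMem (show x ∉ {x | m ≤ F x} from h), add_zero]
            exact ENNReal.ofReal_le_ofReal (by linarith)
  have hsq : P ^ 2 + N ^ 2 ≤ I ^ 2 :=
    calc P ^ 2 + N ^ 2 ≤ P ^ 2 + (m' * (1 / 2)) ^ 2 := by gcongr
      _ ≤ P ^ 2 + (m' * (1 / 2)) ^ 2 + 2 * P * (m' * (1 / 2)) := le_self_add
      _ = (P + m' * (1 / 2)) ^ 2 := by ring
      _ ≤ I ^ 2 := by gcongr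
  calc ∫⁻ x, ENNReal.ofReal (F x) ^ 2 ∂μ
      ≤ (a + ENNReal.ofReal k * P ^ 2) + (b + ENNReal.ofReal k * N ^ 2) + I ^ 2 :=
        hvar.trans (by gcongr)
    _ = (a + b) + (I ^ 2 + ENNReal.ofReal k * (P ^ 2 + N ^ 2)) := by ring
    _ ≤ c + (I ^ 2 + ENNReal.ofReal k * I ^ 2) := by gcongr
    _ = c + ENNReal.ofReal (1 + k) * I ^ 2 := by
        rw [ENNReal.ofReal_add zero_le_one hk, ENNReal.ofReal_one]
        ring

end Median

/-! ### The super-Poincaré inequality -/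

section SuperPoincare

open Set Filter Topology

variable {d : ℕ} {M : Type*} [EMetricSpace M] [SecondCountableTopology M]
    [ChartedSpace (EuclideanSpace ℝ (Fin d)) M]
    [RiemannianBundle (fun x : M ↦ TangentSpace (𝓡 d) x)]
    [MeasurableSpace M] [BorelSpace M] {μ : Measure M}

/-- The inequality for a function that vanishes on a set of measure at least `1/2`: the capacitary
inequality applies to `ν = g μ`, where `g` is the weight of `u`. -/
theorem lintegral_sq_le_of_measure_pos_le_half [IsFiniteMeasure μ] [NullSingletonClass μ]
    {b : ℝ≥0∞} {k : ℝ} (hb : b ≠ 0) (hb' : b ≠ ⊤) (hk : 0 ≤ k)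
    (h : ∀ A : Set M, MeasurableSet A → μ A < 1 / 2 →
      1 / b * (μ A / (1 + ENNReal.ofReal k * μ A)) ≤ capacity d μ A)
    {u : M → ℝ} (hu : LocallyLipschitz u) (hu0 : ∀ x, 0 ≤ u x) (hμ : μ {x | 0 < u x} ≤ 1 / 2)
    {ρ : M → ℝ≥0∞} (hd : ∀ x, 0 < u x → (∃ y, u x < u y) →
      MDifferentiableAt (𝓡 d) 𝓘(ℝ, ℝ) u x ∧ ‖gradient d u x‖ₑ ≤ ρ x) :
    ∫⁻ x, ENNReal.ofReal (u x) ^ 2 ∂μ ≤ 4 * b * ∫⁻ x in {x | 0 < u x}, ρ x ^ 2 ∂μ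
      + ENNReal.ofReal k * (∫⁻ x, ENNReal.ofReal (u x) ∂μ) ^ 2 := by
  have hum : Measurable u := hu.continuous.measurable
  -- for `k = 0` no weight is needed; this also covers the case `∫ u = ∞`
  rcases hk.eq_or_lt with rfl | hkpos
  · refine (lintegral_sq_le_of_capacity hu hu0 hd hb hb' fun t ht ↦ ?_).trans le_self_add
    have := profile_le_relCapacity hb hb' ENNReal.ofReal_ne_top h
      (A := {x | t ≤ u x}) (Ω := {x | 0 < u x})
      (hum measurableSet_Ici) (hum measurableSet_Ioi) (fun x hx ↦ ht.trans_le hx) hμ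
    simpa using this
  set I := ∫⁻ x, ENNReal.ofReal (u x) ∂μ with hI
  by_cases hI0 : I = 0
  · have h1 : (fun x ↦ ENNReal.ofReal (u x)) =ᵐ[μ] 0 :=
      (lintegral_eq_zero_iff (by fun_prop)).1 hI0
    have h2 : ∫⁻ x, ENNReal.ofReal (u x) ^ 2 ∂μ = 0 := by
      rw [lintegral_eq_zero_iff (by fun_prop)]
      filter_upwards [h1] with x hx
      simpa using hx
    rw [h2]
    exact bot_le
  by_cases hItop : I = ⊤
  · rw [hItop, ENNReal.top_pow two_ne_zero, ENNReal.mul_top (by simpa using hkpos), add_top]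
    exact le_top
  calc ∫⁻ x, ENNReal.ofReal (u x) ^ 2 ∂μ
      ≤ ∫⁻ x, ENNReal.ofReal (u x) ^ 2 ∂(μ.withDensity (weight (k * I.toReal) u))
        + ENNReal.ofReal (k * I.toReal) * I :=
        lintegral_sq_le_weight hum hu0 (by positivity)
    _ ≤ 4 * b * ∫⁻ x in {x | 0 < u x}, ρ x ^ 2 ∂μ + ENNReal.ofReal (k * I.toReal) * I := by
        gcongr
        refine lintegral_sq_le_of_capacity hu hu0 hd hb hb' fun t ht ↦ ?_
        exact (withDensity_weight_le hu0 hkpos hI0 hItop (hum measurableSet_Ici)).trans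
          (profile_le_relCapacity hb hb' ENNReal.ofReal_ne_top h
            (hum measurableSet_Ici) (hum measurableSet_Ioi) (fun x hx ↦ ht.trans_le hx) hμ)
    _ = _ := by
        rw [ENNReal.ofReal_mul hk, ENNReal.ofReal_toReal hItop]
        ring

end SuperPoincare

end RiemannianCapacity

end

theorem mainTheorem3 (d : ℕ) (hd : 1 ≤ d)
    {M : Type*} [EMetricSpace M] [SecondCountableTopology M]
    [ChartedSpace (EuclideanSpace ℝ (Fin d)) M] [IsManifold (𝓡 d) ∞ M]
    [RiemannianBundle (fun x : M ↦ TangentSpace (𝓡 d) x)]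
    [IsContMDiffRiemannianBundle (𝓡 d) ∞ (EuclideanSpace ℝ (Fin d))
      (fun x : M ↦ TangentSpace (𝓡 d) x)]
    [IsRiemannianManifold (𝓡 d) M]
    [MeasurableSpace M] [BorelSpace M]
    (μ : Measure M) [IsProbabilityMeasure μ]
    (hμ : μ ≪ RiemannianCapacity.riemannianVolume d M)
    (β : ℝ → ℝ) (hβ : ∀ s : ℝ, 1 ≤ s → 0 ≤ β s)
    (hcap : ∀ A : Set M, MeasurableSet A → μ A < 1 / 2 →
      (⨆ (s : ℝ) (_ : 1 ≤ s),
          1 / ENNReal.ofReal (β s) * (μ A / (1 + ENNReal.ofReal (s - 1) * μ A)))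
        ≤ RiemannianCapacity.capacity d μ A)
    (f : M → ℝ) (hf : ContMDiff (𝓡 d) 𝓘(ℝ, ℝ) ∞ f) (s : ℝ) (hs : 1 ≤ s) :
    ∫⁻ x, ‖f x‖ₑ ^ 2 ∂μ ≤
      4 * ENNReal.ofReal (β s) * RiemannianCapacity.energy d μ f
        + ENNReal.ofReal s * (∫⁻ x, ‖f x‖ₑ ∂μ) ^ 2 := by
  open RiemannianCapacity in
  have : NullSingletonClass (riemannianVolume d M) := nullSingletonClass_riemannianVolume hd
  have : NullSingletonClass μ := ⟨fun x ↦ hμ (measure_singleton x)⟩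
  have hcap' : ∀ A : Set M, MeasurableSet A → μ A < 1 / 2 →
      1 / ENNReal.ofReal (β s) * (μ A / (1 + ENNReal.ofReal (s - 1) * μ A)) ≤ capacity d μ A :=
    fun A hA hlt ↦ (le_iSup₂ (f := fun (s : ℝ) (_ : 1 ≤ s) ↦
      1 / ENNReal.ofReal (β s) * (μ A / (1 + ENNReal.ofReal (s - 1) * μ A))) s hs).trans
      (hcap A hA hlt)
  have hb := (pos_of_forall_le_capacity ENNReal.ofReal_ne_top hcap').ne'
  have hfl : LocallyLipschitz f := locallyLipschitz_of_contMDiff hf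
  have hfd : MDifferentiable (𝓡 d) 𝓘(ℝ, ℝ) f := hf.mdifferentiable (by simp)
  have hFm : Measurable fun x ↦ |f x| := hfl.continuous.abs.measurable
  obtain ⟨m, hm, hm1, hm2⟩ := exists_median (μ := μ) hFm fun x ↦ abs_nonneg (f x)
  have habs : LipschitzWith 1 fun y : ℝ ↦ |y| := lipschitzWith_one_norm
  have hψ₁ : LipschitzWith 1 fun y : ℝ ↦ max (|y| - m) 0 := by
    refine LipschitzWith.max_const ?_ 0
    simpa using habs.sub (LipschitzWith.const m)
  have hψ₂ : LipschitzWith 1 fun y : ℝ ↦ max (m - |y|) 0 := by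
    refine LipschitzWith.max_const ?_ 0
    simpa using (LipschitzWith.const m).sub habs
  have hpos₁ : {x | 0 < max (|f x| - m) 0} = {x | m < |f x|} := by
    ext x
    simp
  have hpos₂ : {x | 0 < max (m - |f x|) 0} = {x | |f x| < m} := by
    ext x
    simp
  -- the part above the median, then the part below
  have key₁ := lintegral_sq_le_of_measure_pos_le_half hb ENNReal.ofReal_ne_top (sub_nonneg.2 hs)
    hcap' (u := fun x ↦ max (|f x| - m) 0) (ρ := fun x ↦ ‖gradient d f x‖ₑ)
    (hψ₁.locallyLipschitz.comp hfl) (fun x ↦ le_max_right _ _) (hpos₁ ▸ hm1) fun x hx _ ↦ by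
      refine mdifferentiableAt_comp_and_enorm_gradient_le hψ₁ ?_ (hfd x)
      have hx' : m < |f x| := by simpa using hx
      have h0 : f x ≠ 0 := abs_pos.1 (hm.trans_lt hx')
      refine ((differentiableAt_abs h0).sub_const m).congr_of_eventuallyEq ?_
      filter_upwards [continuous_abs.continuousAt.eventually_const_lt hx'] with y hy
      exact max_eq_left (sub_nonneg.2 hy.le)
  have key₂ := lintegral_sq_le_of_measure_pos_le_half hb ENNReal.ofReal_ne_top (sub_nonneg.2 hs)
    hcap' (u := fun x ↦ max (m - |f x|) 0) (ρ := fun x ↦ ‖gradient d f x‖ₑ)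
    (hψ₂.locallyLipschitz.comp hfl) (fun x ↦ le_max_right _ _) (hpos₂ ▸ hm2) fun x hx hmax ↦ by
      refine mdifferentiableAt_comp_and_enorm_gradient_le hψ₂ ?_ (hfd x)
      have hx' : |f x| < m := by simpa using hx
      -- `f` does not vanish at `x`, where `u` would be maximal
      have h0 : f x ≠ 0 := by
        rintro h0
        obtain ⟨y, hy⟩ := hmax
        have : max (m - |f y|) 0 ≤ m := max_le (by linarith [abs_nonneg (f y)]) hm
        rw [h0, abs_zero, sub_zero, max_eq_left hm] at hy
        exact absurd hy (not_lt.2 this)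
      refine ((differentiableAt_abs h0).const_sub m).congr_of_eventuallyEq ?_
      filter_upwards [continuous_abs.continuousAt.eventually_lt_const hx'] with y hy
      exact max_eq_left (sub_nonneg.2 hy.le)
  have hpart : ∀ y : ℝ, ENNReal.ofReal (max y 0) = ENNReal.ofReal y := fun y ↦ by
    rw [ENNReal.ofReal_max, ENNReal.ofReal_zero]
    exact max_eq_left bot_le
  simp only [hpos₁, hpos₂, hpart] at key₁ key₂
  have hsum : 4 * ENNReal.ofReal (β s) * ∫⁻ x in {x | m < |f x|}, ‖gradient d f x‖ₑ ^ 2 ∂μ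
      + 4 * ENNReal.ofReal (β s) * ∫⁻ x in {x | |f x| < m}, ‖gradient d f x‖ₑ ^ 2 ∂μ
      ≤ 4 * ENNReal.ofReal (β s) * energy d μ f := by
    have hmeas : MeasurableSet {x | |f x| < m} := hFm measurableSet_Iio
    have hdisj : Disjoint {x | m < |f x|} {x | |f x| < m} :=
      Set.disjoint_left.2 fun x h1 h2 ↦ lt_asymm (show m < |f x| from h1) h2
    rw [← mul_add, ← lintegral_union hmeas hdisj]
    exact mul_le_mul_right (setLIntegral_le_lintegral _ _) _
  have main := lintegral_sq_le_of_parts hFm (fun x ↦ abs_nonneg (f x)) hm hm2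
    (sub_nonneg.2 hs) hsum key₁ key₂
  have hnorm : ∀ x, ENNReal.ofReal |f x| = ‖f x‖ₑ := fun x ↦ by
    rw [← Real.norm_eq_abs, ofReal_norm]
  simpa only [hnorm, add_sub_cancel] using main
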